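/- Let $\mathscr{C}$ be a finitely cocomplete regular Mal'tsev category, i.e. a category with finite limits and finite colimits in which regular epimorphisms are stable under pullback (regularity) and in which every internal reflexive relation is an equivalence relation (Mal'tsev). Let $\mathrm{Grpd}(\mathscr{C})$ be the category of internal groupoids in $\mathscr{C}$ and internal functors, and let $\mathrm{Grpd}^2(\mathscr{C})=\mathrm{Grpd}(\mathrm{Grpd}(\mathscr{C}))$ be the category of internal double groupoids in $\mathscr{C}$. A double groupoid $\mathbb{C}$ has an underlying double reflexive graph, consisting of two rows $$d^1,c^1\colon C^1_1\rightrightarrows C^1_0,\quad e^1\colon C^1_0\to C^1_1,\qquad d^0,c^0\colon C^0_1\rightrightarrows C^0_0,\quad e^0\colon C^0_0\to C^0_1,$$ and two columns $$d_1,c_1\colon C^1_1\rightrightarrows C^0_1,\quad e_1\colon C^0_1\to C^1_1,\qquad d_0,c_0\colon C^1_0\rightrightarrows C^0_0,\quad e_0\colon C^0_0\to C^1_0.$$ Let $2\text{-}\mathrm{Grpd}(\mathscr{C})$ be the full subcategory of $\mathrm{Grpd}^2(\mathscr{C})$ on the internal $2$-groupoids, i.e. the double groupoids for which $e^0$ is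 an isomorphism. Then $2\text{-}\mathrm{Grpd}(\mathscr{C})$ is a Birkhoff subcategory of $\mathrm{Grpd}^2(\mathscr{C})$: it is a replete full reflective subcategory that is closed under subobjects and under regular quotients. Moreover, the reflector $\mathsf{F}$ and the unit $\eta$ of the reflection can be described as follows. For a double groupoid $\mathbb{C}$ with reflection $\eta_{\mathbb{C}}\colon\mathbb{C}\to\mathbb{F}=\mathsf{F}(\mathbb{C})$: the morphism $\eta^0_0\colon C^0_0\to F^0_0$ is the coequalizer of $d^0$ and $c^0$; identifying $F^0_1$ with $F^0_0$ by means of the isomorphism $e^0$ of $\mathbb{F}$, one has $\eta^0_1=\eta^0_0d^0=\eta^0_0c^0$; the object $F^1_0$, with $\eta^1_0\colon C^1_0\to F^1_0$ and the map $e_0\colon F^0_0\to F^1_0$ of $\mathbb{F}$, is the pushout of $\eta^0_0$ along $e_0\colon C^0_0\to C^1_0$; and the object $F^1_1$, with $\eta^1_1\colon C^1_1\to F^1_1$ and the map $e_1\colon F^0_1\to F^1_1$ of $\mathbb{F}$, is the pushout of $\eta^0_1$ along $e_1\colon C^0_1\to C^1_1$. -/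

import Mathlib

open CategoryTheory Limits

universe v u

/-- A Mal'tsev category: every internal reflexive relation is an equivalence relation
(finite completeness is required through the separate instance `HasFiniteLimits`). -/
class IsMaltsev (C : Type u) [Category.{v} C] [HasFiniteLimits C] : Prop where
  isEquivalenceRelation {R X : C} (p₁ p₂ : R ⟶ X) (h : ReflexiveRelation p₁ p₂) :
    IsEquivalenceRelation p₁ p₂

/-- An internal reflexive graph: `d` is the domain, `c` the codomain, `e` the common section. -/
structure InternalReflexiveGraph (C : Type u) [Category.{v} C] where
  /-- the object of objects -/
  obj : C
  /-- the object of arrows -/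
  arr : C
  d : arr ⟶ obj
  c : arr ⟶ obj
  e : obj ⟶ arr
  e_d : e ≫ d = 𝟙 obj
  e_c : e ≫ c = 𝟙 obj

/-- A reflexive graph with a composition `m`, defined on the pullback `comps` of `c` along `d`
(the object of composable pairs), with the right domain and codomain. -/
structure InternalCompGraph (C : Type u) [Category.{v} C] extends InternalReflexiveGraph C where
  /-- the object of composable pairs -/
  comps : C
  p₁ : comps ⟶ arr
  p₂ : comps ⟶ arr
  isPullback : IsPullback p₁ p₂ c d
  m : comps ⟶ arr
  m_d : m ≫ d = p₁ ≫ d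
  m_c : m ≫ c = p₂ ≫ c

namespace InternalCompGraph

variable {C : Type u} [Category.{v} C] (X : InternalCompGraph C)

/-- The composite (in diagrammatic order) of two composable generalized arrows. -/
noncomputable def mul {T : C} (f g : T ⟶ X.arr) (w : f ≫ X.c = g ≫ X.d) : T ⟶ X.arr :=
  X.isPullback.lift f g w ≫ X.m

lemma mul_d {T : C} (f g : T ⟶ X.arr) (w : f ≫ X.c = g ≫ X.d) :
    X.mul f g w ≫ X.d = f ≫ X.d := by
  simp [mul, X.m_d]

lemma mul_c {T : C} (f g : T ⟶ X.arr) (w : f ≫ X.c = g ≫ X.d) :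
    X.mul f g w ≫ X.c = g ≫ X.c := by
  simp [mul, X.m_c]

end InternalCompGraph

/-- An internal category. -/
structure InternalCategory (C : Type u) [Category.{v} C] extends InternalCompGraph C where
  id_mul : toInternalCompGraph.mul (d ≫ e) (𝟙 arr)
    ((Category.assoc d e c).trans (by rw [e_c, Category.comp_id, Category.id_comp])) = 𝟙 arr
  mul_id : toInternalCompGraph.mul (𝟙 arr) (c ≫ e)
    (Eq.trans (by rw [e_d, Category.comp_id, Category.id_comp]) (Category.assoc c e d).symm) = 𝟙 arr
  assoc {T : C} (f g h : T ⟶ arr) (w : f ≫ c = g ≫ d) (w' : g ≫ c = h ≫ d) :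
    toInternalCompGraph.mul (toInternalCompGraph.mul f g w) h
        ((toInternalCompGraph.mul_c f g w).trans w') =
      toInternalCompGraph.mul f (toInternalCompGraph.mul g h w')
        (w.trans (toInternalCompGraph.mul_d g h w').symm)

/-- An internal groupoid: an internal category with an inversion morphism `i`
(which is then unique). -/
structure InternalGroupoid (C : Type u) [Category.{v} C] extends InternalCategory C where
  i : arr ⟶ arr
  i_d : i ≫ d = c
  i_c : i ≫ c = d
  mul_i : toInternalCompGraph.mul (𝟙 arr) i ((Category.id_comp c).trans i_d.symm) = d ≫ e
  i_mul : toInternalCompGraph.mul i (𝟙 arr) (i_c.trans (Category.id_comp d).symm) = c ≫ e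

namespace InternalGroupoid

variable {C : Type u} [Category.{v} C]

/-- Internal functors between internal groupoids. -/
@[ext]
structure Hom (X Y : InternalGroupoid C) where
  /-- the component on objects -/
  f₀ : X.obj ⟶ Y.obj
  /-- the component on arrows -/
  f₁ : X.arr ⟶ Y.arr
  d_f₀ : X.d ≫ f₀ = f₁ ≫ Y.d
  c_f₀ : X.c ≫ f₀ = f₁ ≫ Y.c
  e_f₁ : X.e ≫ f₁ = f₀ ≫ Y.e
  m_f₁ : X.m ≫ f₁ = Y.mul (X.p₁ ≫ f₁) (X.p₂ ≫ f₁) (by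
    rw [Category.assoc, Category.assoc, ← c_f₀, ← d_f₀, X.isPullback.w_assoc])

/-- The category of internal groupoids in `C` and internal functors. -/
instance : Category (InternalGroupoid C) where
  Hom := Hom
  id X :=
    { f₀ := 𝟙 _
      f₁ := 𝟙 _
      d_f₀ := by simp
      c_f₀ := by simp
      e_f₁ := by simp
      m_f₁ := by
        have h : X.isPullback.lift X.p₁ X.p₂ X.isPullback.w = 𝟙 _ := by
          apply X.isPullback.hom_ext <;> simp
        simp [InternalCompGraph.mul, h] }
  comp {X Y Z} f g :=
    { f₀ := f.f₀ ≫ g.f₀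
      f₁ := f.f₁ ≫ g.f₁
      d_f₀ := by rw [← Category.assoc, f.d_f₀, Category.assoc, g.d_f₀, Category.assoc]
      c_f₀ := by rw [← Category.assoc, f.c_f₀, Category.assoc, g.c_f₀, Category.assoc]
      e_f₁ := by rw [← Category.assoc, f.e_f₁, Category.assoc, g.e_f₁, Category.assoc]
      m_f₁ := by
        rw [← Category.assoc, f.m_f₁]
        simp only [InternalCompGraph.mul, Category.assoc, g.m_f₁]
        simp only [← Category.assoc]
        congr 1
        apply Z.isPullback.hom_ext <;> simp }
  id_comp f := by apply Hom.ext <;> simp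
  comp_id f := by apply Hom.ext <;> simp
  assoc f g h := by apply Hom.ext <;> simp

end InternalGroupoid

/-- Internal double groupoids: internal groupoids in the category of internal groupoids.

For `X : DoubleGroupoid C`, the underlying double reflexive graph has
* bottom row `X.obj`, with objects `X.obj.arr ⇉ X.obj.obj` and maps
  `d⁰ = X.obj.d`, `c⁰ = X.obj.c`, `e⁰ = X.obj.e`;
* top row `X.arr`, with objects `X.arr.arr ⇉ X.arr.obj` and maps `d¹, c¹, e¹`;
* columns given by the two components of `X.d`, `X.c`, `X.e`: e.g. `e₀ = X.e.f₀` goes from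
  `X.obj.obj` to `X.arr.obj`, and `e₁ = X.e.f₁` from `X.obj.arr` to `X.arr.arr`. -/
abbrev DoubleGroupoid (C : Type u) [Category.{v} C] := InternalGroupoid (InternalGroupoid C)

/-- The internal double groupoids that are internal 2-groupoids: `e⁰` is an isomorphism. -/
def isTwoGroupoid (C : Type u) [Category.{v} C] : ObjectProperty (DoubleGroupoid C) :=
  fun X => IsIso X.obj.e

/-- The category of internal 2-groupoids, a full subcategory of that of double groupoids. -/
abbrev TwoGroupoid (C : Type u) [Category.{v} C] := (isTwoGroupoid C).FullSubcategory

/-- The full subcategory of `D` on the objects satisfying `P` is a Birkhoff subcategory: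
replete, reflective, closed under subobjects and under regular quotients. -/
structure IsBirkhoff {D : Type u} [Category.{v} D] (P : ObjectProperty D) : Prop where
  replete : P.IsClosedUnderIsomorphisms
  reflective : Nonempty (Reflective P.ι)
  subobjects : P.IsClosedUnderSubobjects
  regularQuotients : ∀ ⦃X Y : D⦄ (f : X ⟶ Y), IsRegularEpi f → P X → P Y

/-- A morphism `η : X ⟶ Y` of double groupoids, where `Y` is a 2-groupoid, is obtained by the
coequalizer-and-pushouts construction:
* `η⁰₀` is the coequalizer of `d⁰` and `c⁰`;
* `Y¹₀`, with `η¹₀` and its map `e₀`, is the pushout of `η⁰₀` along `e₀`;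
* `η⁰₁` is `η⁰₀ d⁰` (`Y⁰₁` being identified with `Y⁰₀` by means of `e⁰`);
* `Y¹₁`, with `η¹₁` and its map `e₁`, is the pushout of `η⁰₁` along `e₁`.
The remaining structure maps of the double graph underlying `Y` are then the maps induced by the
universal properties of these colimits, because `η` is a morphism of double groupoids. -/
structure IsCoequalizerPushoutConstruction {C : Type u} [Category.{v} C] {X Y : DoubleGroupoid C}
    (η : X ⟶ Y) : Prop where
  isTwoGroupoid : isTwoGroupoid C Y
  w : X.obj.d ≫ η.f₀.f₀ = X.obj.c ≫ η.f₀.f₀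
  isCoequalizer : Nonempty (IsColimit (Cofork.ofπ η.f₀.f₀ w))
  isPushout₀ : IsPushout X.e.f₀ η.f₀.f₀ η.f₁.f₀ Y.e.f₀
  η₁_eq : η.f₀.f₁ = (X.obj.d ≫ η.f₀.f₀) ≫ Y.obj.e
  isPushout₁ : IsPushout X.e.f₁ η.f₀.f₁ η.f₁.f₁ Y.e.f₁

-- Relations in a Mal'tsev category are difunctional. Hence two natural operations on the composable
-- pairs of a reflexive graph agree as soon as they agree on pairs containing an identity
-- (`operation_ext`). So a composition with units is automatically associative and is preserved by
-- every morphism of reflexive graphs; a morphism of reflexive graphs between groupoids is already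
-- an internal functor.
--
-- With regularity this gives stability under quotients (`quotientStructure`). If a morphism of
-- reflexive graphs is a regular epimorphism on arrows, composable pairs lift along it locally, and
-- the image of a composite depends only on the images of its factors. Composition, and likewise
-- inversion, then descends from a groupoid to its quotient.
--
-- The bottom row of a 2-groupoid is discrete, so a morphism into one coequalizes `d⁰` and `c⁰`. At
-- the level of reflexive graphs this forces the reflection: the coequalizer in the bottom row, then
-- pushouts along the identities of the two columns. The pushout legs are regular epimorphisms, so
-- the columns and the top row are quotients of groupoids, hence groupoids. Levelwise structures
-- assemble into a double groupoid because all compatibilities are automatic (`structureOfLevels`).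
-- For the same reason the universal property reduces to those of the coequalizer and the pushouts.
--
-- For closure, discrete and indiscrete groupoids play the role of left and right adjoints to the
-- functor taking the object of objects, which therefore preserves monomorphisms and regular
-- epimorphisms. A subobject of a double groupoid thus restricts to a subobject of bottom rows, and
-- a regular quotient to a regular quotient of bottom rows; both inherit discreteness.

attribute [local simp] pullback.lift_fst pullback.lift_snd pullback.lift_fst_assoc
  pullback.lift_snd_assoc prod.lift_fst prod.lift_snd prod.lift_fst_assoc prod.lift_snd_assoc

/-! ### Difunctional relations in Mal'tsev categories -/

section Maltsev

variable {C : Type u} [Category.{v} C]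

/-- Relations in a Mal'tsev category are difunctional. -/
theorem IsMaltsev.difunctional [HasFiniteLimits C] [IsMaltsev C] {R A B T : C}
    (r₁ : R ⟶ A) (r₂ : R ⟶ B) [hr : JointlyMono₂ r₁ r₂] (x y z : T ⟶ R)
    (h₂ : x ≫ r₂ = y ≫ r₂) (h₁ : y ≫ r₁ = z ≫ r₁) :
    ∃ w : T ⟶ R, w ≫ r₁ = x ≫ r₁ ∧ w ≫ r₂ = z ≫ r₂ := by
  -- `K` consists of triples `(π₁, ρ, π₂)` where `ρ` shares its `r₁` with `π₁` and its `r₂` with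
  -- `π₂`. Since `ρ` is determined by the outer terms, `K` is a reflexive relation on `R`. Applying
  -- symmetry to `(z, y, x)` yields a triple `(x, w, z)`, whose middle term is the required element.
  let K := pullback (pullback.snd r₁ r₁ ≫ r₂) r₂
  let π₁ : K ⟶ R := pullback.fst _ _ ≫ pullback.fst _ _
  let ρ : K ⟶ R := pullback.fst _ _ ≫ pullback.snd _ _
  let π₂ : K ⟶ R := pullback.snd _ _
  have e₁ : ρ ≫ r₁ = π₁ ≫ r₁ := by simp [ρ, π₁, pullback.condition]
  have e₂ : ρ ≫ r₂ = π₂ ≫ r₂ := by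
    have := pullback.condition (f := pullback.snd r₁ r₁ ≫ r₂) (g := r₂)
    simpa [ρ, π₂] using this
  have refl : ReflexiveRelation π₁ π₂ :=
    { right_cancellation := fun Y f g h h' => by
        apply pullback.hom_ext
        · apply pullback.hom_ext
          · simpa [π₁] using h
          · apply hr.right_cancellation
            · have := congr($h ≫ r₁)
              simp only [Category.assoc, ← e₁] at this
              simpa [ρ] using this
            · have := congr($h' ≫ r₂)
              simp only [Category.assoc, ← e₂] at this
              simpa [ρ] using this
        · exact h'
      r := pullback.lift (pullback.lift (𝟙 _) (𝟙 _) rfl) (𝟙 _) (by simp [pullback.lift_snd_assoc])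
      reflexivity₁ := by simp [π₁, pullback.lift_fst, pullback.lift_fst_assoc]
      reflexivity₂ := by simp [π₂, pullback.lift_snd] }
  obtain ⟨⟨h⟩⟩ := IsMaltsev.isEquivalenceRelation π₁ π₂ refl
  let k : T ⟶ K := pullback.lift (pullback.lift z y h₁.symm) x
    (by simpa [pullback.lift_snd_assoc] using h₂.symm)
  refine ⟨k ≫ h.s ≫ ρ, ?_, ?_⟩
  · simp only [Category.assoc, e₁, h.symmetry₁_assoc]
    simp [k, π₂, pullback.lift_snd_assoc]
  · simp only [Category.assoc, e₂, h.symmetry₂_assoc]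
    simp [k, π₁, pullback.lift_fst_assoc]

/-- Two natural operations on the pairs `(a, b)` of generalized elements with `u a = v b` which
agree on `(a, b')`, `(a', b')` and `(a', b)` agree on `(a, b)`. -/
theorem IsMaltsev.operation_ext [HasFiniteLimits C] [IsMaltsev C] {A B S W : C}
    (u : A ⟶ S) (v : B ⟶ S)
    (φ ψ : ∀ {T : C} (a : T ⟶ A) (b : T ⟶ B), a ≫ u = b ≫ v → (T ⟶ W))
    (hφ : ∀ {T T' : C} (t : T' ⟶ T) (a : T ⟶ A) (b : T ⟶ B) (w : a ≫ u = b ≫ v),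
      t ≫ φ a b w = φ (t ≫ a) (t ≫ b) (by simp [w]))
    (hψ : ∀ {T T' : C} (t : T' ⟶ T) (a : T ⟶ A) (b : T ⟶ B) (w : a ≫ u = b ≫ v),
      t ≫ ψ a b w = ψ (t ≫ a) (t ≫ b) (by simp [w]))
    {T : C} (a a' : T ⟶ A) (b b' : T ⟶ B) (w : a ≫ u = b ≫ v)
    (w₁ : a ≫ u = b' ≫ v) (w₂ : a' ≫ u = b' ≫ v) (w₃ : a' ≫ u = b ≫ v)
    (h₁ : φ a b' w₁ = ψ a b' w₁) (h₂ : φ a' b' w₂ = ψ a' b' w₂) (h₃ : φ a' b w₃ = ψ a' b w₃) :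
    φ a b w = ψ a b w := by
  let P := pullback u v
  let Φ : P ⟶ W := φ (pullback.fst u v) (pullback.snd u v) pullback.condition
  let Ψ : P ⟶ W := ψ (pullback.fst u v) (pullback.snd u v) pullback.condition
  have key : ∀ (a : T ⟶ A) (b : T ⟶ B) (w : a ≫ u = b ≫ v),
      pullback.lift a b w ≫ Φ = φ a b w ∧ pullback.lift a b w ≫ Ψ = ψ a b w := by
    intro a b w
    constructor
    · simp only [Φ, hφ, pullback.lift_fst, pullback.lift_snd]
    · simp only [Ψ, hψ, pullback.lift_fst, pullback.lift_snd]
  have lft : ∀ (a : T ⟶ A) (b : T ⟶ B) (w : a ≫ u = b ≫ v), φ a b w = ψ a b w →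
      ∃ x : T ⟶ equalizer Φ Ψ, x ≫ equalizer.ι Φ Ψ = pullback.lift a b w := fun a b w h =>
    ⟨equalizer.lift (pullback.lift a b w) (by rw [(key a b w).1, (key a b w).2, h]), by simp⟩
  obtain ⟨x, hx⟩ := lft _ _ _ h₁
  obtain ⟨y, hy⟩ := lft _ _ _ h₂
  obtain ⟨z, hz⟩ := lft _ _ _ h₃
  -- The pairs on which the operations agree form a relation between `A` and `B`, to which
  -- difunctionality applies.
  have : JointlyMono₂ (equalizer.ι Φ Ψ ≫ pullback.fst u v) (equalizer.ι Φ Ψ ≫ pullback.snd u v) :=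
    ⟨fun Y f g h h' => by
      rw [← cancel_mono (equalizer.ι Φ Ψ)]
      apply pullback.hom_ext
      · simpa using h
      · simpa using h'⟩
  obtain ⟨r, hr₁, hr₂⟩ := IsMaltsev.difunctional (equalizer.ι Φ Ψ ≫ pullback.fst u v)
    (equalizer.ι Φ Ψ ≫ pullback.snd u v) x y z
    (by simp [reassoc_of% hx, reassoc_of% hy, pullback.lift_snd])
    (by simp [reassoc_of% hy, reassoc_of% hz, pullback.lift_fst])
  have hr : r ≫ equalizer.ι Φ Ψ = pullback.lift a b w := by
    apply pullback.hom_ext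
    · simpa [reassoc_of% hx, pullback.lift_fst] using hr₁
    · simpa [reassoc_of% hz, pullback.lift_snd] using hr₂
  rw [← (key a b w).1, ← (key a b w).2, ← hr, Category.assoc, Category.assoc,
    equalizer.condition]

end Maltsev

/-! ### Regular epimorphisms and local lifting -/

section Regular

variable {C : Type u} [Category.{v} C]

theorem IsRegularEpi.comp_of_regular [Regular C] {X Y Z : C} (f : X ⟶ Y) (g : Y ⟶ Z)
    [IsRegularEpi f] [IsRegularEpi g] : IsRegularEpi (f ≫ g) := by
  have : StrongEpi (f ≫ g) := strongEpi_comp f g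
  infer_instance

theorem IsRegularEpi.of_comp [Regular C] {X Y Z : C} (f : X ⟶ Y) (g : Y ⟶ Z)
    [IsRegularEpi (f ≫ g)] : IsRegularEpi g := by
  have : StrongEpi g := strongEpi_of_strongEpi f g
  infer_instance

theorem IsRegularEpi.exists_lift [Regular C] {X Y T : C} (f : X ⟶ Y) [IsRegularEpi f]
    (y : T ⟶ Y) : ∃ (T' : C) (t : T' ⟶ T) (x : T' ⟶ X), IsRegularEpi t ∧ x ≫ f = t ≫ y :=
  ⟨pullback f y, pullback.snd f y, pullback.fst f y, inferInstance, pullback.condition⟩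

theorem IsRegularEpi.of_isPushout {P Q R S : C} {f : P ⟶ Q} {g : P ⟶ R} {h : Q ⟶ S} {k : R ⟶ S}
    (sq : IsPushout f g h k) [IsRegularEpi g] : IsRegularEpi h :=
  ⟨⟨regularOfIsPushoutSndOfRegular (IsRegularEpi.getStruct g) sq.w sq.isColimit⟩⟩

end Regular

/-! ### Compositions on reflexive graphs, by generalized elements -/

namespace InternalReflexiveGraph

variable {C : Type u} [Category.{v} C]

attribute [simp] e_d e_c

@[simp]
lemma e_d_assoc (G : InternalReflexiveGraph C) {T : C} (f : G.obj ⟶ T) : G.e ≫ G.d ≫ f = f := by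
  rw [← Category.assoc, G.e_d, Category.id_comp]

@[simp]
lemma e_c_assoc (G : InternalReflexiveGraph C) {T : C} (f : G.obj ⟶ T) : G.e ≫ G.c ≫ f = f := by
  rw [← Category.assoc, G.e_c, Category.id_comp]

/-- The image of an internal reflexive graph under a functor. -/
abbrev map {D : Type*} [Category* D] (G : InternalReflexiveGraph C) (F : C ⥤ D) :
    InternalReflexiveGraph D where
  obj := F.obj G.obj
  arr := F.obj G.arr
  d := F.map G.d
  c := F.map G.c
  e := F.map G.e
  e_d := by rw [← F.map_comp, e_d, F.map_id]
  e_c := by rw [← F.map_comp, e_c, F.map_id]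

/-- Morphisms of internal reflexive graphs. -/
structure GraphHom (G H : InternalReflexiveGraph C) where
  /-- the component on objects -/
  f₀ : G.obj ⟶ H.obj
  /-- the component on arrows -/
  f₁ : G.arr ⟶ H.arr
  d_f₀ : G.d ≫ f₀ = f₁ ≫ H.d
  c_f₀ : G.c ≫ f₀ = f₁ ≫ H.c
  e_f₁ : G.e ≫ f₁ = f₀ ≫ H.e

/-- The composition of morphisms of reflexive graphs. -/
def GraphHom.comp {G H K : InternalReflexiveGraph C} (φ : GraphHom G H) (ψ : GraphHom H K) :
    GraphHom G K where
  f₀ := φ.f₀ ≫ ψ.f₀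
  f₁ := φ.f₁ ≫ ψ.f₁
  d_f₀ := by rw [← Category.assoc, φ.d_f₀, Category.assoc, ψ.d_f₀, Category.assoc]
  c_f₀ := by rw [← Category.assoc, φ.c_f₀, Category.assoc, ψ.c_f₀, Category.assoc]
  e_f₁ := by rw [← Category.assoc, φ.e_f₁, Category.assoc, ψ.e_f₁, Category.assoc]

/-- The image of a morphism of reflexive graphs under a functor. -/
def GraphHom.map {D : Type*} [Category* D] {G H : InternalReflexiveGraph C} (φ : GraphHom G H)
    (F : C ⥤ D) : GraphHom (G.map F) (H.map F) where
  f₀ := F.map φ.f₀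
  f₁ := F.map φ.f₁
  d_f₀ := by simp only [← F.map_comp, φ.d_f₀]
  c_f₀ := by simp only [← F.map_comp, φ.c_f₀]
  e_f₁ := by simp only [← F.map_comp, φ.e_f₁]

/-- The morphism between the images of a reflexive graph given by a natural transformation. -/
def mapNatTrans {D : Type*} [Category* D] (G : InternalReflexiveGraph C) {F F' : C ⥤ D}
    (τ : F ⟶ F') : GraphHom (G.map F) (G.map F') where
  f₀ := τ.app G.obj
  f₁ := τ.app G.arr
  d_f₀ := τ.naturality G.d
  c_f₀ := τ.naturality G.c
  e_f₁ := τ.naturality G.e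

lemma GraphHom.comp_eq {G H : InternalReflexiveGraph C} (φ : GraphHom G H) {T : C}
    {f g : T ⟶ G.arr} (w : f ≫ G.c = g ≫ G.d) : (f ≫ φ.f₁) ≫ H.c = (g ≫ φ.f₁) ≫ H.d := by
  rw [Category.assoc, Category.assoc, ← φ.c_f₀, ← φ.d_f₀, ← Category.assoc, w, Category.assoc]

/-- A composition law with units on an internal reflexive graph, in terms of generalized arrows. -/
structure UnitalComposition (G : InternalReflexiveGraph C) where
  /-- the composite (in diagrammatic order) of two composable generalized arrows -/
  mul {T : C} (f g : T ⟶ G.arr) (w : f ≫ G.c = g ≫ G.d) : T ⟶ G.arr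
  comp_mul {T T' : C} (t : T' ⟶ T) (f g : T ⟶ G.arr) (w : f ≫ G.c = g ≫ G.d) :
    t ≫ mul f g w = mul (t ≫ f) (t ≫ g) (by simp [w])
  mul_d {T : C} (f g : T ⟶ G.arr) (w : f ≫ G.c = g ≫ G.d) : mul f g w ≫ G.d = f ≫ G.d
  mul_c {T : C} (f g : T ⟶ G.arr) (w : f ≫ G.c = g ≫ G.d) : mul f g w ≫ G.c = g ≫ G.c
  id_mul {T : C} (f : T ⟶ G.arr) : mul (f ≫ G.d ≫ G.e) f (by simp) = f
  mul_id {T : C} (f : T ⟶ G.arr) : mul f (f ≫ G.c ≫ G.e) (by simp) = f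

/-- A groupoid structure on an internal reflexive graph, in terms of generalized arrows. -/
structure GroupoidStructure (G : InternalReflexiveGraph C) extends UnitalComposition G where
  assoc {T : C} (f g h : T ⟶ G.arr) (w : f ≫ G.c = g ≫ G.d) (w' : g ≫ G.c = h ≫ G.d) :
    mul (mul f g w) h ((mul_c f g w).trans w') = mul f (mul g h w') (w.trans (mul_d g h w').symm)
  /-- the inversion -/
  i : G.arr ⟶ G.arr
  i_d : i ≫ G.d = G.c
  i_c : i ≫ G.c = G.d
  mul_i {T : C} (f : T ⟶ G.arr) : mul f (f ≫ i) (by simp [i_d]) = f ≫ G.d ≫ G.e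
  i_mul {T : C} (f : T ⟶ G.arr) : mul (f ≫ i) f (by simp [i_c]) = f ≫ G.c ≫ G.e

namespace UnitalComposition

variable {G : InternalReflexiveGraph C} (S : UnitalComposition G)

lemma mul_congr {T : C} {f f' g g' : T ⟶ G.arr} (h : f = f') (h' : g = g')
    (w : f ≫ G.c = g ≫ G.d) : S.mul f g w = S.mul f' g' (by rw [← h, ← h', w]) := by
  subst h h'
  rfl

lemma id_mul_of_eq {T : C} (f g : T ⟶ G.arr) (x : T ⟶ G.obj) (h : f = x ≫ G.e)
    (w : f ≫ G.c = g ≫ G.d) : S.mul f g w = g := by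
  have h' : f = g ≫ G.d ≫ G.e := by
    rw [h] at w ⊢
    rw [← Category.assoc g, ← w]
    simp
  rw [S.mul_congr h' rfl, S.id_mul]

lemma mul_id_of_eq {T : C} (f g : T ⟶ G.arr) (x : T ⟶ G.obj) (h : g = x ≫ G.e)
    (w : f ≫ G.c = g ≫ G.d) : S.mul f g w = f := by
  have h' : g = f ≫ G.c ≫ G.e := by
    rw [h] at w ⊢
    rw [← Category.assoc f, w]
    simp
  rw [S.mul_congr rfl h', S.mul_id]

end UnitalComposition

section Groupoid

variable {G : InternalReflexiveGraph C}

/-- The composition graph given by a composition on an internal reflexive graph. -/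
noncomputable abbrev UnitalComposition.toCompGraph [HasPullbacks C] (S : UnitalComposition G) :
    InternalCompGraph C where
  toInternalReflexiveGraph := G
  comps := pullback G.c G.d
  p₁ := pullback.fst _ _
  p₂ := pullback.snd _ _
  isPullback := IsPullback.of_hasPullback _ _
  m := S.mul (pullback.fst _ _) (pullback.snd _ _) pullback.condition
  m_d := S.mul_d _ _ _
  m_c := S.mul_c _ _ _

lemma UnitalComposition.toCompGraph_mul [HasPullbacks C] (S : UnitalComposition G) {T : C}
    (f g : T ⟶ G.arr) (w : f ≫ G.c = g ≫ G.d) : S.toCompGraph.mul f g w = S.mul f g w := by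
  dsimp only [InternalCompGraph.mul]
  rw [S.comp_mul]
  exact S.mul_congr (IsPullback.lift_fst _ _ _ _) (IsPullback.lift_snd _ _ _ _) _

/-- The internal groupoid given by a groupoid structure on an internal reflexive graph. -/
noncomputable abbrev GroupoidStructure.toGroupoid [HasPullbacks C] (S : GroupoidStructure G) :
    InternalGroupoid C where
  toInternalCompGraph := S.toCompGraph
  id_mul := by
    rw [UnitalComposition.toCompGraph_mul]
    exact S.id_mul_of_eq _ _ G.d rfl _
  mul_id := by
    rw [UnitalComposition.toCompGraph_mul]
    exact S.mul_id_of_eq _ _ G.c rfl _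
  assoc f g h w w' := by
    simp only [UnitalComposition.toCompGraph_mul]
    exact S.assoc f g h w w'
  i := S.i
  i_d := S.i_d
  i_c := S.i_c
  mul_i := by
    rw [UnitalComposition.toCompGraph_mul]
    simpa using S.mul_i (𝟙 _)
  i_mul := by
    rw [UnitalComposition.toCompGraph_mul]
    simpa using S.i_mul (𝟙 _)

end Groupoid

/-! ### Automatic associativity and preservation of composition -/

section Maltsev

variable [HasFiniteLimits C] [IsMaltsev C]

/-- Two natural operations on the composable pairs of a reflexive graph in a Mal'tsev category
agree as soon as they agree on the pairs one of whose members is an identity. -/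
theorem operation_ext (G : InternalReflexiveGraph C) {W : C}
    (φ ψ : ∀ {T : C} (f g : T ⟶ G.arr), f ≫ G.c = g ≫ G.d → (T ⟶ W))
    (hφ : ∀ {T T' : C} (t : T' ⟶ T) (f g : T ⟶ G.arr) (w : f ≫ G.c = g ≫ G.d),
      t ≫ φ f g w = φ (t ≫ f) (t ≫ g) (by simp [w]))
    (hψ : ∀ {T T' : C} (t : T' ⟶ T) (f g : T ⟶ G.arr) (w : f ≫ G.c = g ≫ G.d),
      t ≫ ψ f g w = ψ (t ≫ f) (t ≫ g) (by simp [w]))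
    (h₁ : ∀ {T : C} (f : T ⟶ G.arr) (x : T ⟶ G.obj) (w : f ≫ G.c = (x ≫ G.e) ≫ G.d),
      φ f (x ≫ G.e) w = ψ f (x ≫ G.e) w)
    (h₂ : ∀ {T : C} (x : T ⟶ G.obj) (g : T ⟶ G.arr) (w : (x ≫ G.e) ≫ G.c = g ≫ G.d),
      φ (x ≫ G.e) g w = ψ (x ≫ G.e) g w)
    {T : C} (f g : T ⟶ G.arr) (w : f ≫ G.c = g ≫ G.d) : φ f g w = ψ f g w :=
  IsMaltsev.operation_ext G.c G.d φ ψ hφ hψ f ((f ≫ G.c) ≫ G.e) g ((f ≫ G.c) ≫ G.e) w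
    (by simp) (by simp) (by simp [w]) (h₁ _ _ _) (h₁ _ _ _) (h₂ _ _ _)

/-- Morphisms of reflexive graphs preserve unital compositions in a Mal'tsev category. -/
theorem GraphHom.mul_f₁ {G H : InternalReflexiveGraph C} (φ : GraphHom G H)
    (S : UnitalComposition G) (S' : UnitalComposition H) {T : C} (f g : T ⟶ G.arr)
    (w : f ≫ G.c = g ≫ G.d) :
    S.mul f g w ≫ φ.f₁ = S'.mul (f ≫ φ.f₁) (g ≫ φ.f₁) (φ.comp_eq w) := by
  refine G.operation_ext (fun f g w => S.mul f g w ≫ φ.f₁)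
    (fun f g w => S'.mul (f ≫ φ.f₁) (g ≫ φ.f₁) (φ.comp_eq w)) ?_ ?_ ?_ ?_ f g w
  · intro T T' t f g w
    rw [← Category.assoc, S.comp_mul]
  · intro T T' t f g w
    rw [S'.comp_mul]
    exact S'.mul_congr (Category.assoc _ _ _).symm (Category.assoc _ _ _).symm _
  · intro T f x w
    rw [S.mul_id_of_eq _ _ x rfl, S'.mul_id_of_eq _ _ (x ≫ φ.f₀) (by simp [φ.e_f₁])]
  · intro T x g w
    rw [S.id_mul_of_eq _ _ x rfl, S'.id_mul_of_eq _ _ (x ≫ φ.f₀) (by simp [φ.e_f₁])]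

namespace UnitalComposition

variable {G : InternalReflexiveGraph C} (S : UnitalComposition G)

/-- Unital compositions in a Mal'tsev category are associative. -/
theorem assoc {T : C} (f g h : T ⟶ G.arr) (w : f ≫ G.c = g ≫ G.d) (w' : g ≫ G.c = h ≫ G.d) :
    S.mul (S.mul f g w) h ((S.mul_c f g w).trans w') =
      S.mul f (S.mul g h w') (w.trans (S.mul_d g h w').symm) := by
  have hc : ∀ {T : C} (a : T ⟶ pullback G.c G.d),
      (a ≫ pullback.fst _ _) ≫ G.c = (a ≫ pullback.snd _ _) ≫ G.d := fun a => by
    simp [pullback.condition]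
  -- The two bracketings are compared as operations on a composable pair `(f, g)` and an arrow `h`.
  -- The reference elements are the pair of identities and the identity at the codomain of `g`; with
  -- either of them the unit laws suffice.
  have key := IsMaltsev.operation_ext (pullback.snd G.c G.d ≫ G.c) G.d
    (fun a z w => S.mul (S.mul (a ≫ pullback.fst _ _) (a ≫ pullback.snd _ _) (hc a)) z
      (by rw [S.mul_c, ← w, Category.assoc]))
    (fun a z w => S.mul (a ≫ pullback.fst _ _) (S.mul (a ≫ pullback.snd _ _) z
      (by rw [← w, Category.assoc])) (by rw [S.mul_d, hc a]))
    (fun t a b w => by simp only [S.comp_mul, Category.assoc])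
    (fun t a b w => by simp only [S.comp_mul, Category.assoc])
    (pullback.lift f g w) (pullback.lift ((g ≫ G.c) ≫ G.e) ((g ≫ G.c) ≫ G.e) (by simp)) h
    ((g ≫ G.c) ≫ G.e) (by simpa using w') (by simp) (by simp) (by simpa using w')
    (by
      rw [S.mul_id_of_eq _ _ (g ≫ G.c) rfl]
      apply S.mul_congr rfl
      rw [S.mul_id_of_eq _ _ (g ≫ G.c) rfl])
    (by
      rw [S.mul_id_of_eq _ _ (g ≫ G.c) rfl]
      apply S.mul_congr rfl
      rw [S.mul_id_of_eq _ _ (g ≫ G.c) rfl])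
    (by
      rw [S.id_mul_of_eq (pullback.lift _ _ _ ≫ _) (S.mul _ _ _) (g ≫ G.c) (by simp)]
      refine S.mul_congr ?_ rfl _
      rw [S.id_mul_of_eq _ _ (g ≫ G.c) (by simp)])
  simpa using key

/-- Inverses for a unital composition in a Mal'tsev category are unique. -/
theorem inv_unique {T : C} (f g g' : T ⟶ G.arr) (w : g ≫ G.c = f ≫ G.d)
    (w' : f ≫ G.c = g' ≫ G.d) (h : S.mul g f w = f ≫ G.c ≫ G.e)
    (h' : S.mul f g' w' = f ≫ G.d ≫ G.e) : g = g' := by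
  have := S.assoc g f g' w w'
  rw [S.id_mul_of_eq _ _ (f ≫ G.c) (by simpa using h),
    S.mul_id_of_eq _ _ (f ≫ G.d) (by simpa using h')] at this
  exact this.symm

end UnitalComposition

/-- Morphisms of reflexive graphs preserve inverses in a Mal'tsev category. -/
theorem GraphHom.i_f₁ {G H : InternalReflexiveGraph C} (φ : GraphHom G H)
    (S : GroupoidStructure G) (S' : GroupoidStructure H) : S.i ≫ φ.f₁ = φ.f₁ ≫ S'.i := by
  refine S'.inv_unique φ.f₁ _ _ ?_ (by simp [S'.i_d]) ?_ (S'.mul_i _)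
  · rw [Category.assoc, ← φ.c_f₀, ← φ.d_f₀, ← Category.assoc, S.i_c]
  · have := φ.mul_f₁ S.toUnitalComposition S'.toUnitalComposition (𝟙 _ ≫ S.i) (𝟙 _)
      (by simp [S.i_c])
    rw [S.i_mul] at this
    refine (S'.mul_congr (by simp) (by simp) _).trans (this.symm.trans ?_)
    rw [Category.id_comp, Category.assoc, φ.e_f₁, ← Category.assoc, φ.c_f₀, Category.assoc]

end Maltsev

end InternalReflexiveGraph

/-! ### Functors as graph morphisms, and transport along functors -/

namespace InternalGroupoid

open InternalReflexiveGraph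

variable {C : Type u} [Category.{v} C]

lemma hom_ext {X Y : InternalGroupoid C} {f g : X ⟶ Y} (h₀ : f.f₀ = g.f₀) (h₁ : f.f₁ = g.f₁) :
    f = g := Hom.ext h₀ h₁

/-- The groupoid structure of an internal groupoid on its underlying reflexive graph. -/
noncomputable def groupoidStructure (X : InternalGroupoid C) :
    GroupoidStructure X.toInternalReflexiveGraph :=
  have comp_mul : ∀ {T T' : C} (t : T' ⟶ T) (f g : T ⟶ X.arr) (w : f ≫ X.c = g ≫ X.d),
      t ≫ X.mul f g w = X.mul (t ≫ f) (t ≫ g) (by simp [w]) := fun t f g w => by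
    simp only [InternalCompGraph.mul, ← Category.assoc]
    congr 1
    apply X.isPullback.hom_ext <;> simp
  { mul := X.mul
    comp_mul := comp_mul
    mul_d := X.mul_d
    mul_c := X.mul_c
    id_mul := fun f => by
      have := congr(f ≫ $(X.id_mul))
      rw [comp_mul] at this
      simpa using this
    mul_id := fun f => by
      have := congr(f ≫ $(X.mul_id))
      rw [comp_mul] at this
      simpa using this
    assoc := X.assoc
    i := X.i
    i_d := X.i_d
    i_c := X.i_c
    mul_i := fun f => by
      have := congr(f ≫ $(X.mul_i))
      rw [comp_mul] at this
      simpa using this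
    i_mul := fun f => by
      have := congr(f ≫ $(X.i_mul))
      rw [comp_mul] at this
      simpa using this }

/-- The morphism of reflexive graphs underlying an internal functor. -/
def Hom.toGraphHom {X Y : InternalGroupoid C} (f : X ⟶ Y) :
    GraphHom X.toInternalReflexiveGraph Y.toInternalReflexiveGraph where
  f₀ := f.f₀
  f₁ := f.f₁
  d_f₀ := f.d_f₀
  c_f₀ := f.c_f₀
  e_f₁ := f.e_f₁

lemma Hom.mul_f₁ {X Y : InternalGroupoid C} (φ : X ⟶ Y) {T : C} (f g : T ⟶ X.arr)
    (w : f ≫ X.c = g ≫ X.d) :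
    X.mul f g w ≫ φ.f₁ = Y.mul (f ≫ φ.f₁) (g ≫ φ.f₁) ((Hom.toGraphHom φ).comp_eq w) := by
  change (_ ≫ _) ≫ _ = _
  rw [Category.assoc, φ.m_f₁]
  refine (Y.groupoidStructure.comp_mul _ _ _ _).trans ?_
  apply Y.groupoidStructure.mul_congr <;> simp

/-- The internal functor given by a morphism of reflexive graphs preserving the composition. -/
def homMk {X Y : InternalGroupoid C}
    (φ : GraphHom X.toInternalReflexiveGraph Y.toInternalReflexiveGraph)
    (h : ∀ {T : C} (f g : T ⟶ X.arr) (w : f ≫ X.c = g ≫ X.d),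
      X.mul f g w ≫ φ.f₁ = Y.mul (f ≫ φ.f₁) (g ≫ φ.f₁) (φ.comp_eq w)) : X ⟶ Y where
  f₀ := φ.f₀
  f₁ := φ.f₁
  d_f₀ := φ.d_f₀
  c_f₀ := φ.c_f₀
  e_f₁ := φ.e_f₁
  m_f₁ := by
    rw [← h _ _ X.isPullback.w]
    have : X.isPullback.lift X.p₁ X.p₂ X.isPullback.w = 𝟙 _ := by
      apply X.isPullback.hom_ext <;> simp
    simp [InternalCompGraph.mul, this]

/-- In a Mal'tsev category, every morphism of reflexive graphs between internal groupoids is an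
internal functor. -/
noncomputable def homOfGraphHom [HasFiniteLimits C] [IsMaltsev C] {X Y : InternalGroupoid C}
    (φ : GraphHom X.toInternalReflexiveGraph Y.toInternalReflexiveGraph) : X ⟶ Y :=
  homMk φ fun f g w => φ.mul_f₁ X.groupoidStructure.toUnitalComposition
    Y.groupoidStructure.toUnitalComposition f g w

section Maltsev

variable [HasFiniteLimits C] [IsMaltsev C] {X Y : InternalGroupoid C}
    (φ : GraphHom X.toInternalReflexiveGraph Y.toInternalReflexiveGraph)

/-- The image of an internal groupoid under a functor to a Mal'tsev category which preserves the
pullback of composable pairs is a groupoid. -/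
noncomputable def mapGroupoidStructure {D : Type*} [Category* D] (X : InternalGroupoid D)
    (F : D ⥤ C) [PreservesLimit (cospan X.c X.d) F] :
    GroupoidStructure (X.toInternalReflexiveGraph.map F) :=
  have h := X.isPullback.map F
  have comp_lift : ∀ {T T' : C} (t : T' ⟶ T) (f g : T ⟶ F.obj X.arr)
      (w : f ≫ F.map X.c = g ≫ F.map X.d),
      t ≫ h.lift f g w = h.lift (t ≫ f) (t ≫ g) (by simp [w]) := fun t f g w => by
    apply h.hom_ext <;> simp
  have lift_map : ∀ {T : C} {Z : D} (f g : Z ⟶ X.arr) (w : f ≫ X.c = g ≫ X.d)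
      (t : T ⟶ F.obj Z) (f' g' : T ⟶ F.obj X.arr) (w' : f' ≫ F.map X.c = g' ≫ F.map X.d),
      f' = t ≫ F.map f → g' = t ≫ F.map g →
      h.lift f' g' w' ≫ F.map X.m = t ≫ F.map (X.mul f g w) := fun f g w t f' g' w' hf hg => by
    rw [InternalCompGraph.mul, F.map_comp, ← Category.assoc]
    congr 1
    apply h.hom_ext <;> simp [hf, hg, ← F.map_comp]
  let S : UnitalComposition (X.toInternalReflexiveGraph.map F) :=
    { mul := fun f g w => h.lift f g w ≫ F.map X.m
      comp_mul := fun t f g w => by rw [← Category.assoc, comp_lift]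
      mul_d := fun f g w => by
        rw [Category.assoc, ← F.map_comp, X.m_d, F.map_comp, h.lift_fst_assoc]
      mul_c := fun f g w => by
        rw [Category.assoc, ← F.map_comp, X.m_c, F.map_comp, h.lift_snd_assoc]
      id_mul := fun f => by
        refine (lift_map _ _ _ f _ _ _ (by simp) (by simp)).trans
          ((congr(f ≫ F.map $(X.id_mul))).trans (by simp))
      mul_id := fun f => by
        refine (lift_map _ _ _ f _ _ _ (by simp) (by simp)).trans
          ((congr(f ≫ F.map $(X.mul_id))).trans (by simp)) }
  { S with
    -- Associativity comes from the Mal'tsev property of `C`, so `F` need not preserve the object of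
    -- composable triples.
    assoc := S.assoc
    i := F.map X.i
    i_d := by simp [← F.map_comp, X.i_d]
    i_c := by simp [← F.map_comp, X.i_c]
    mul_i := fun f => by
      refine (lift_map _ _ _ f _ _ _ (by simp) (by simp)).trans
        ((congr(f ≫ F.map $(X.mul_i))).trans (by simp))
    i_mul := fun f => by
      refine (lift_map _ _ _ f _ _ _ (by simp) (by simp)).trans
        ((congr(f ≫ F.map $(X.i_mul))).trans (by simp)) }

/-- Allows the preservation of composition in a double groupoid to be checked separately on objects
and on arrows. -/
lemma functor_map_mul {D : Type*} [Category* D] (X : InternalGroupoid D) (F : D ⥤ C)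
    [PreservesLimit (cospan X.c X.d) F] {T : D} (f g : T ⟶ X.arr) (w : f ≫ X.c = g ≫ X.d) :
    F.map (X.mul f g w) = (X.mapGroupoidStructure F).mul (F.map f) (F.map g)
      (by rw [← F.map_comp, w, F.map_comp]) := by
  rw [InternalCompGraph.mul, F.map_comp]
  change _ = _ ≫ _
  congr 1
  apply (X.isPullback.map F).hom_ext <;> simp [← F.map_comp]

end Maltsev

end InternalGroupoid

/-! ### Regular quotients of groupoids -/

namespace InternalReflexiveGraph

variable {C : Type u} [Category.{v} C] [Regular C] [IsMaltsev C]

namespace GraphHom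

variable {G H : InternalReflexiveGraph C} (φ : GraphHom G H)

/-- The kernel pair of `φ` is a reflexive graph `K`. Composing the first components or the second
components and then applying `φ` gives two operations on it, which agree when one factor is an
identity. -/
lemma mul_f₁_eq_mul_f₁ (S : UnitalComposition G) {T : C} {f f' g g' : T ⟶ G.arr}
    (w : f ≫ G.c = g ≫ G.d) (w' : f' ≫ G.c = g' ≫ G.d) (hf : f ≫ φ.f₁ = f' ≫ φ.f₁)
    (hg : g ≫ φ.f₁ = g' ≫ φ.f₁) : S.mul f g w ≫ φ.f₁ = S.mul f' g' w' ≫ φ.f₁ := by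
  let K : InternalReflexiveGraph C :=
    { obj := pullback φ.f₀ φ.f₀
      arr := pullback φ.f₁ φ.f₁
      d := pullback.lift (pullback.fst _ _ ≫ G.d) (pullback.snd _ _ ≫ G.d)
        (by simp [φ.d_f₀, pullback.condition_assoc])
      c := pullback.lift (pullback.fst _ _ ≫ G.c) (pullback.snd _ _ ≫ G.c)
        (by simp [φ.c_f₀, pullback.condition_assoc])
      e := pullback.lift (pullback.fst _ _ ≫ G.e) (pullback.snd _ _ ≫ G.e)
        (by simp [φ.e_f₁, pullback.condition_assoc])
      e_d := by apply pullback.hom_ext <;> simp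
      e_c := by apply pullback.hom_ext <;> simp }
  have hc₁ : ∀ {T : C} {a b : T ⟶ pullback φ.f₁ φ.f₁}, a ≫ K.c = b ≫ K.d →
      (a ≫ pullback.fst _ _) ≫ G.c = (b ≫ pullback.fst _ _) ≫ G.d := fun w => by
    simpa [K] using congr($w ≫ pullback.fst _ _)
  have hc₂ : ∀ {T : C} {a b : T ⟶ pullback φ.f₁ φ.f₁}, a ≫ K.c = b ≫ K.d →
      (a ≫ pullback.snd _ _) ≫ G.c = (b ≫ pullback.snd _ _) ≫ G.d := fun w => by
    simpa [K] using congr($w ≫ pullback.snd _ _)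
  have key := K.operation_ext (W := H.arr)
    (fun a b w => S.mul (a ≫ pullback.fst _ _) (b ≫ pullback.fst _ _) (hc₁ w) ≫ φ.f₁)
    (fun a b w => S.mul (a ≫ pullback.snd _ _) (b ≫ pullback.snd _ _) (hc₂ w) ≫ φ.f₁)
    (fun t a b w => by simp only [← Category.assoc, S.comp_mul])
    (fun t a b w => by simp only [← Category.assoc, S.comp_mul])
    (fun a x w => by
      rw [S.mul_id_of_eq _ _ (x ≫ pullback.fst _ _) (by simp [K]),
        S.mul_id_of_eq _ _ (x ≫ pullback.snd _ _) (by simp [K])]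
      simp [pullback.condition])
    (fun x b w => by
      rw [S.id_mul_of_eq _ _ (x ≫ pullback.fst _ _) (by simp [K]),
        S.id_mul_of_eq _ _ (x ≫ pullback.snd _ _) (by simp [K])]
      simp [pullback.condition])
    (pullback.lift f f' hf) (pullback.lift g g' hg)
    (by apply pullback.hom_ext <;> simp [K, w, w'])
  simpa using key

/-- The comparison morphism between the objects of composable pairs. -/
noncomputable def mapComposable : pullback G.c G.d ⟶ pullback H.c H.d :=
  pullback.lift (pullback.fst _ _ ≫ φ.f₁) (pullback.snd _ _ ≫ φ.f₁)
    (φ.comp_eq pullback.condition)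

lemma comp_mul_f₁_eq_of_comp_mapComposable_eq (S : UnitalComposition G) {Z : C}
    (a b : Z ⟶ pullback G.c G.d) (h : a ≫ φ.mapComposable = b ≫ φ.mapComposable) :
    a ≫ S.mul (pullback.fst _ _) (pullback.snd _ _) pullback.condition ≫ φ.f₁ =
      b ≫ S.mul (pullback.fst _ _) (pullback.snd _ _) pullback.condition ≫ φ.f₁ := by
  rw [← Category.assoc, ← Category.assoc, S.comp_mul, S.comp_mul]
  apply φ.mul_f₁_eq_mul_f₁
  · simpa [mapComposable] using congr($h ≫ pullback.fst _ _)
  · simpa [mapComposable] using congr($h ≫ pullback.snd _ _)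

variable [IsRegularEpi φ.f₁]

/-- In a regular Mal'tsev category, an arrow of a regular quotient of a reflexive graph can locally
be lifted to an arrow with a given domain. -/
theorem exists_lift_of_d {T : C} (x : T ⟶ G.obj) (y : T ⟶ H.arr) (w : x ≫ φ.f₀ = y ≫ H.d) :
    ∃ (T' : C) (t : T' ⟶ T) (k : T' ⟶ G.arr), IsRegularEpi t ∧ k ≫ G.d = t ≫ x ∧
      k ≫ φ.f₁ = t ≫ y := by
  let F := Regular.strongEpiMonoFactorisation (prod.lift G.d φ.f₁)
  have : IsRegularEpi F.e := inferInstance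
  have h₁ : F.e ≫ F.m ≫ prod.fst = G.d := by rw [F.fac_assoc, prod.lift_fst]
  have h₂ : F.e ≫ F.m ≫ prod.snd = φ.f₁ := by rw [F.fac_assoc, prod.lift_snd]
  have : JointlyMono₂ (F.m ≫ prod.fst) (F.m ≫ prod.snd) := ⟨fun Y f g h h' => by
    rw [← cancel_mono F.m]
    apply Limits.prod.hom_ext
    · simpa using h
    · simpa using h'⟩
  obtain ⟨T₁, t₁, y₁, ht₁, hy₁⟩ := IsRegularEpi.exists_lift φ.f₁ y
  -- The relation is the image of `(G.d, φ.f₁)`. The identity at `x`, the identity at the domain of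
  -- a local lift `y₁` of `y`, and `y₁` itself give three of its elements; difunctionality produces
  -- the pair `(x, y)`.
  obtain ⟨r, hr₁, hr₂⟩ := IsMaltsev.difunctional (F.m ≫ prod.fst) (F.m ≫ prod.snd)
    ((t₁ ≫ x ≫ G.e) ≫ F.e) ((y₁ ≫ G.d ≫ G.e) ≫ F.e) (y₁ ≫ F.e)
    (by simp [h₂, φ.e_f₁, reassoc_of% w, reassoc_of% φ.d_f₀, reassoc_of% hy₁])
    (by simp [h₁])
  obtain ⟨T₂, t₂, k, ht₂, hk⟩ := IsRegularEpi.exists_lift F.e r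
  refine ⟨T₂, t₂ ≫ t₁, k, IsRegularEpi.comp_of_regular _ _, ?_, ?_⟩
  · rw [← h₁, reassoc_of% hk, hr₁]
    simp [h₁]
  · rw [← h₂, reassoc_of% hk, hr₂]
    simp [h₂, hy₁]

/-- In a regular Mal'tsev category, composable pairs of arrows of a regular quotient of a reflexive
graph can locally be lifted. -/
theorem exists_lift_of_comp {T : C} (f g : T ⟶ H.arr) (w : f ≫ H.c = g ≫ H.d) :
    ∃ (T' : C) (t : T' ⟶ T) (f' g' : T' ⟶ G.arr), IsRegularEpi t ∧ f' ≫ G.c = g' ≫ G.d ∧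
      f' ≫ φ.f₁ = t ≫ f ∧ g' ≫ φ.f₁ = t ≫ g := by
  obtain ⟨T₁, t₁, f₁, ht₁, hf₁⟩ := IsRegularEpi.exists_lift φ.f₁ f
  obtain ⟨T₂, t₂, g₂, ht₂, hd, hg₂⟩ := φ.exists_lift_of_d (f₁ ≫ G.c) (t₁ ≫ g)
    (by simp [φ.c_f₀, reassoc_of% hf₁, w])
  exact ⟨T₂, t₂ ≫ t₁, t₂ ≫ f₁, g₂, IsRegularEpi.comp_of_regular _ _, by simp [hd],
    by simp [hf₁], by simp [hg₂]⟩

/-- Lifting the universal composable pair exhibits a regular epimorphism factoring through the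
comparison. -/
instance : IsRegularEpi φ.mapComposable := by
  obtain ⟨T, t, f, g, ht, w, hf, hg⟩ := φ.exists_lift_of_comp (pullback.fst H.c H.d)
    (pullback.snd H.c H.d) pullback.condition
  have : pullback.lift f g w ≫ φ.mapComposable = t := by
    apply pullback.hom_ext <;> simp [mapComposable, hf, hg]
  have : IsRegularEpi (pullback.lift f g w ≫ φ.mapComposable) := by rwa [this]
  exact IsRegularEpi.of_comp (pullback.lift f g w) _

/-- The composition on a regular quotient of a reflexive graph with a unital composition. -/
noncomputable def quotientMul (S : UnitalComposition G) : pullback H.c H.d ⟶ H.arr :=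
  EffectiveEpi.desc φ.mapComposable
    (S.mul (pullback.fst _ _) (pullback.snd _ _) pullback.condition ≫ φ.f₁)
    (φ.comp_mul_f₁_eq_of_comp_mapComposable_eq S)

lemma mapComposable_quotientMul (S : UnitalComposition G) : φ.mapComposable ≫ φ.quotientMul S =
    S.mul (pullback.fst _ _) (pullback.snd _ _) pullback.condition ≫ φ.f₁ := by
  exact EffectiveEpi.fac _ _ (φ.comp_mul_f₁_eq_of_comp_mapComposable_eq S)

lemma lift_quotientMul (S : UnitalComposition G) {T : C} (f g : T ⟶ G.arr)
    (w : f ≫ G.c = g ≫ G.d) {f' g' : T ⟶ H.arr} (w' : f' ≫ H.c = g' ≫ H.d)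
    (hf : f ≫ φ.f₁ = f') (hg : g ≫ φ.f₁ = g') :
    pullback.lift f' g' w' ≫ φ.quotientMul S = S.mul f g w ≫ φ.f₁ := by
  have : pullback.lift f' g' w' = pullback.lift f g w ≫ φ.mapComposable := by
    apply pullback.hom_ext <;> simp [mapComposable, hf, hg]
  rw [this, Category.assoc, mapComposable_quotientMul, ← Category.assoc, S.comp_mul]
  simp

/-- The unital composition on a regular quotient. -/
noncomputable def quotientComposition (S : UnitalComposition G) : UnitalComposition H where
  mul f g w := pullback.lift f g w ≫ φ.quotientMul S
  comp_mul t f g w := by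
    rw [← Category.assoc]
    congr 1
    apply pullback.hom_ext <;> simp
  mul_d f g w := by
    -- As `t` is an epimorphism, the equation may be checked on the lifted pair, where it comes from
    -- `G`. The remaining laws are handled in the same way.
    obtain ⟨T, t, f', g', ht, w', hf, hg⟩ := φ.exists_lift_of_comp f g w
    have : Epi t := inferInstance
    have h : t ≫ pullback.lift (f := H.c) (g := H.d) f g w = pullback.lift (t ≫ f) (t ≫ g) (by simp [w]) := by
      apply pullback.hom_ext <;> simp
    rw [← cancel_epi t, ← Category.assoc, ← Category.assoc, h,
      φ.lift_quotientMul S f' g' w' _ hf hg, Category.assoc, ← φ.d_f₀, ← Category.assoc, S.mul_d,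
      Category.assoc, φ.d_f₀, reassoc_of% hf]
  mul_c f g w := by
    obtain ⟨T, t, f', g', ht, w', hf, hg⟩ := φ.exists_lift_of_comp f g w
    have : Epi t := inferInstance
    have h : t ≫ pullback.lift (f := H.c) (g := H.d) f g w = pullback.lift (t ≫ f) (t ≫ g) (by simp [w]) := by
      apply pullback.hom_ext <;> simp
    rw [← cancel_epi t, ← Category.assoc, ← Category.assoc, h,
      φ.lift_quotientMul S f' g' w' _ hf hg, Category.assoc, ← φ.c_f₀, ← Category.assoc, S.mul_c,
      Category.assoc, φ.c_f₀, reassoc_of% hg]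
  id_mul f := by
    obtain ⟨T, t, f', ht, hf⟩ := IsRegularEpi.exists_lift φ.f₁ f
    have : Epi t := inferInstance
    have h : t ≫ pullback.lift (f := H.c) (g := H.d) (f ≫ H.d ≫ H.e) f (by simp) =
        pullback.lift (t ≫ f ≫ H.d ≫ H.e) (t ≫ f) (by simp) := by
      apply pullback.hom_ext <;> simp
    rw [← cancel_epi t, ← Category.assoc, h, φ.lift_quotientMul S (f' ≫ G.d ≫ G.e) f' (by simp)
      (f' := t ≫ f ≫ H.d ≫ H.e) (g' := t ≫ f) (by simp)
      (by simp [φ.e_f₁, reassoc_of% φ.d_f₀, reassoc_of% hf]) hf, S.id_mul, hf]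
  mul_id f := by
    obtain ⟨T, t, f', ht, hf⟩ := IsRegularEpi.exists_lift φ.f₁ f
    have : Epi t := inferInstance
    have h : t ≫ pullback.lift (f := H.c) (g := H.d) f (f ≫ H.c ≫ H.e) (by simp) =
        pullback.lift (t ≫ f) (t ≫ f ≫ H.c ≫ H.e) (by simp) := by
      apply pullback.hom_ext <;> simp
    rw [← cancel_epi t, ← Category.assoc, h, φ.lift_quotientMul S f' (f' ≫ G.c ≫ G.e) (by simp)
      (f' := t ≫ f) (g' := t ≫ f ≫ H.c ≫ H.e) (by simp)
      hf (by simp [φ.e_f₁, reassoc_of% φ.c_f₀, reassoc_of% hf]), S.mul_id, hf]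

/-- In a regular Mal'tsev category, a regular quotient of a groupoid is a groupoid. -/
noncomputable def quotientStructure (S : GroupoidStructure G) : GroupoidStructure H :=
  let S' := φ.quotientComposition S.toUnitalComposition
  have mul_i : ∀ {T : C} (x : T ⟶ G.arr) (f : T ⟶ H.arr) (w : f ≫ H.c = (x ≫ S.i ≫ φ.f₁) ≫ H.d),
      x ≫ φ.f₁ = f → S'.mul f (x ≫ S.i ≫ φ.f₁) w = f ≫ H.d ≫ H.e := fun x f w hf => by
    refine (φ.lift_quotientMul S.toUnitalComposition x (x ≫ S.i) (by simp [S.i_d]) w hf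
      (by simp)).trans ?_
    rw [S.mul_i, ← hf]
    simp [φ.e_f₁, reassoc_of% φ.d_f₀]
  have i_mul : ∀ {T : C} (x : T ⟶ G.arr) (f : T ⟶ H.arr) (w : (x ≫ S.i ≫ φ.f₁) ≫ H.c = f ≫ H.d),
      x ≫ φ.f₁ = f → S'.mul (x ≫ S.i ≫ φ.f₁) f w = f ≫ H.c ≫ H.e := fun x f w hf => by
    refine (φ.lift_quotientMul S.toUnitalComposition (x ≫ S.i) x (by simp [S.i_c]) w
      (by simp) hf).trans ?_
    rw [S.i_mul, ← hf]
    simp [φ.e_f₁, reassoc_of% φ.c_f₀]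
  have hd : S.i ≫ φ.f₁ ≫ H.d = φ.f₁ ≫ H.c := by
    rw [← φ.d_f₀, reassoc_of% S.i_d, φ.c_f₀]
  have hc : S.i ≫ φ.f₁ ≫ H.c = φ.f₁ ≫ H.d := by
    rw [← φ.c_f₀, reassoc_of% S.i_c, φ.d_f₀]
  -- If `x` and `x'` have the same image, the images of their inverses are both inverse to it, hence
  -- equal.
  let i : H.arr ⟶ H.arr := EffectiveEpi.desc φ.f₁ (S.i ≫ φ.f₁) (fun x x' h =>
    S'.inv_unique (x ≫ φ.f₁) _ _ (by simp [hc]) (by rw [h]; simp [hd]) (i_mul x _ _ rfl)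
      (mul_i x' _ _ h.symm))
  have fac : φ.f₁ ≫ i = S.i ≫ φ.f₁ := by apply EffectiveEpi.fac
  have i_d : i ≫ H.d = H.c := by
    rw [← cancel_epi φ.f₁, reassoc_of% fac, hd]
  have i_c : i ≫ H.c = H.d := by
    rw [← cancel_epi φ.f₁, reassoc_of% fac, hc]
  { S' with
    assoc := S'.assoc
    i := i
    i_d := i_d
    i_c := i_c
    mul_i := fun f => by
      obtain ⟨T, t, x, ht, hf⟩ := IsRegularEpi.exists_lift φ.f₁ f
      have : Epi t := inferInstance
      rw [← cancel_epi t, S'.comp_mul, S'.mul_congr rfl (show t ≫ f ≫ i = x ≫ S.i ≫ φ.f₁ by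
        rw [← fac, reassoc_of% hf]), mul_i x _ _ hf, Category.assoc]
    i_mul := fun f => by
      obtain ⟨T, t, x, ht, hf⟩ := IsRegularEpi.exists_lift φ.f₁ f
      have : Epi t := inferInstance
      rw [← cancel_epi t, S'.comp_mul, S'.mul_congr (show t ≫ f ≫ i = x ≫ S.i ≫ φ.f₁ by
        rw [← fac, reassoc_of% hf]) rfl, i_mul x _ _ hf, Category.assoc] }

end GraphHom

end InternalReflexiveGraph

/-! ### Object and arrow functors, and pullbacks of groupoids -/

namespace InternalGroupoid

open InternalReflexiveGraph

variable {C : Type u} [Category.{v} C]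

/-- The object of objects of an internal groupoid, as a functor. -/
def objFunctor (C : Type u) [Category.{v} C] : InternalGroupoid C ⥤ C where
  obj X := X.obj
  map f := f.f₀

/-- The object of arrows of an internal groupoid, as a functor. -/
def arrFunctor (C : Type u) [Category.{v} C] : InternalGroupoid C ⥤ C where
  obj X := X.arr
  map f := f.f₁

/-- The domain, as a natural transformation. -/
def dTrans (C : Type u) [Category.{v} C] : arrFunctor C ⟶ objFunctor C where
  app X := X.d
  naturality _ _ f := f.d_f₀.symm

/-- The codomain, as a natural transformation. -/
def cTrans (C : Type u) [Category.{v} C] : arrFunctor C ⟶ objFunctor C where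
  app X := X.c
  naturality _ _ f := f.c_f₀.symm

/-- The identities, as a natural transformation. -/
def eTrans (C : Type u) [Category.{v} C] : objFunctor C ⟶ arrFunctor C where
  app X := X.e
  naturality _ _ f := f.e_f₁.symm

section Pullback

variable [HasFiniteLimits C]

lemma Hom.i_f₁ [IsMaltsev C] {X Y : InternalGroupoid C} (f : X ⟶ Y) :
    X.i ≫ f.f₁ = f.f₁ ≫ Y.i :=
  GraphHom.i_f₁ f.toGraphHom X.groupoidStructure Y.groupoidStructure

variable {X Y Z : InternalGroupoid C} (f : X ⟶ Z) (g : Y ⟶ Z)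

/-- The pullback of internal groupoids, as a reflexive graph. -/
noncomputable abbrev pullbackGraph : InternalReflexiveGraph C where
  obj := pullback f.f₀ g.f₀
  arr := pullback f.f₁ g.f₁
  d := pullback.lift (pullback.fst _ _ ≫ X.d) (pullback.snd _ _ ≫ Y.d)
    (by simp [f.d_f₀, g.d_f₀, pullback.condition_assoc])
  c := pullback.lift (pullback.fst _ _ ≫ X.c) (pullback.snd _ _ ≫ Y.c)
    (by simp [f.c_f₀, g.c_f₀, pullback.condition_assoc])
  e := pullback.lift (pullback.fst _ _ ≫ X.e) (pullback.snd _ _ ≫ Y.e)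
    (by simp [f.e_f₁, g.e_f₁, pullback.condition_assoc])
  e_d := by apply pullback.hom_ext <;> simp
  e_c := by apply pullback.hom_ext <;> simp

variable {f g} in
lemma pullbackGraph_fst_eq {T : C} {a b : T ⟶ (pullbackGraph f g).arr}
    (w : a ≫ (pullbackGraph f g).c = b ≫ (pullbackGraph f g).d) :
    (a ≫ pullback.fst _ _) ≫ X.c = (b ≫ pullback.fst _ _) ≫ X.d := by
  simpa using congr($w ≫ pullback.fst _ _)

variable {f g} in
lemma pullbackGraph_snd_eq {T : C} {a b : T ⟶ (pullbackGraph f g).arr}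
    (w : a ≫ (pullbackGraph f g).c = b ≫ (pullbackGraph f g).d) :
    (a ≫ pullback.snd _ _) ≫ Y.c = (b ≫ pullback.snd _ _) ≫ Y.d := by
  simpa using congr($w ≫ pullback.snd _ _)

/-- The composition on the pullback of internal groupoids. -/
noncomputable def pullbackMul {T : C} (a b : T ⟶ pullback f.f₁ g.f₁)
    (w : a ≫ (pullbackGraph f g).c = b ≫ (pullbackGraph f g).d) : T ⟶ pullback f.f₁ g.f₁ :=
  pullback.lift
    (X.groupoidStructure.mul (a ≫ pullback.fst _ _) (b ≫ pullback.fst _ _)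
      (pullbackGraph_fst_eq w))
    (Y.groupoidStructure.mul (a ≫ pullback.snd _ _) (b ≫ pullback.snd _ _)
      (pullbackGraph_snd_eq w)) (by
    refine (f.mul_f₁ _ _ _).trans (.trans ?_ (g.mul_f₁ _ _ _).symm)
    apply Z.groupoidStructure.mul_congr <;> simp [pullback.condition])

@[simp]
lemma pullbackMul_fst {T : C} (a b : T ⟶ pullback f.f₁ g.f₁)
    (w : a ≫ (pullbackGraph f g).c = b ≫ (pullbackGraph f g).d) :
    pullbackMul f g a b w ≫ pullback.fst _ _ =
      X.groupoidStructure.mul (a ≫ pullback.fst _ _) (b ≫ pullback.fst _ _)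
        (pullbackGraph_fst_eq w) :=
  pullback.lift_fst _ _ _

@[simp]
lemma pullbackMul_snd {T : C} (a b : T ⟶ pullback f.f₁ g.f₁)
    (w : a ≫ (pullbackGraph f g).c = b ≫ (pullbackGraph f g).d) :
    pullbackMul f g a b w ≫ pullback.snd _ _ =
      Y.groupoidStructure.mul (a ≫ pullback.snd _ _) (b ≫ pullback.snd _ _)
        (pullbackGraph_snd_eq w) :=
  pullback.lift_snd _ _ _

/-- The groupoid structure on the pullback of internal groupoids. -/
noncomputable def pullbackStructure [IsMaltsev C] : GroupoidStructure (pullbackGraph f g) where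
  mul a b w := pullbackMul f g a b w
  comp_mul t a b w := by
    apply pullback.hom_ext
    · rw [Category.assoc, pullbackMul_fst, pullbackMul_fst, UnitalComposition.comp_mul]
      simp only [Category.assoc]
    · rw [Category.assoc, pullbackMul_snd, pullbackMul_snd, UnitalComposition.comp_mul]
      simp only [Category.assoc]
  mul_d a b w := by
    apply pullback.hom_ext
    · rw [Category.assoc, pullback.lift_fst, ← Category.assoc, pullbackMul_fst,
        UnitalComposition.mul_d]
      simp
    · rw [Category.assoc, pullback.lift_snd, ← Category.assoc, pullbackMul_snd,
        UnitalComposition.mul_d]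
      simp
  mul_c a b w := by
    apply pullback.hom_ext
    · rw [Category.assoc, pullback.lift_fst, ← Category.assoc, pullbackMul_fst,
        UnitalComposition.mul_c]
      simp
    · rw [Category.assoc, pullback.lift_snd, ← Category.assoc, pullbackMul_snd,
        UnitalComposition.mul_c]
      simp
  id_mul a := by
    apply pullback.hom_ext
    · simpa using X.groupoidStructure.id_mul (a ≫ pullback.fst _ _)
    · simpa using Y.groupoidStructure.id_mul (a ≫ pullback.snd _ _)
  mul_id a := by
    apply pullback.hom_ext
    · simpa [groupoidStructure] using X.groupoidStructure.mul_id (a ≫ pullback.fst _ _)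
    · simpa [groupoidStructure] using Y.groupoidStructure.mul_id (a ≫ pullback.snd _ _)
  assoc a b c w w' := by
    apply pullback.hom_ext
    · simpa using X.groupoidStructure.assoc _ _ _ (pullbackGraph_fst_eq w) (pullbackGraph_fst_eq w')
    · simpa using Y.groupoidStructure.assoc _ _ _ (pullbackGraph_snd_eq w) (pullbackGraph_snd_eq w')
  i := pullback.lift (pullback.fst _ _ ≫ X.i) (pullback.snd _ _ ≫ Y.i) (by
    simp [f.i_f₁, g.i_f₁, pullback.condition_assoc])
  i_d := by apply pullback.hom_ext <;> simp [X.i_d, Y.i_d]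
  i_c := by apply pullback.hom_ext <;> simp [X.i_c, Y.i_c]
  mul_i a := by
    apply pullback.hom_ext
    · simpa [groupoidStructure] using X.groupoidStructure.mul_i (a ≫ pullback.fst _ _)
    · simpa [groupoidStructure] using Y.groupoidStructure.mul_i (a ≫ pullback.snd _ _)
  i_mul a := by
    apply pullback.hom_ext
    · simpa [groupoidStructure] using X.groupoidStructure.i_mul (a ≫ pullback.fst _ _)
    · simpa [groupoidStructure] using Y.groupoidStructure.i_mul (a ≫ pullback.snd _ _)

variable [IsMaltsev C]

/-- The pullback of internal groupoids. -/
noncomputable def pullbackObj : InternalGroupoid C := (pullbackStructure f g).toGroupoid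

/-- The first projection of the pullback of internal groupoids. -/
noncomputable def pullbackFst : pullbackObj f g ⟶ X :=
  homOfGraphHom (X := (pullbackStructure f g).toGroupoid)
    { f₀ := pullback.fst _ _
      f₁ := pullback.fst _ _
      d_f₀ := pullback.lift_fst _ _ _
      c_f₀ := pullback.lift_fst _ _ _
      e_f₁ := pullback.lift_fst _ _ _ }

/-- The second projection of the pullback of internal groupoids. -/
noncomputable def pullbackSnd : pullbackObj f g ⟶ Y :=
  homOfGraphHom (X := (pullbackStructure f g).toGroupoid)
    { f₀ := pullback.snd _ _
      f₁ := pullback.snd _ _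
      d_f₀ := pullback.lift_snd _ _ _
      c_f₀ := pullback.lift_snd _ _ _
      e_f₁ := pullback.lift_snd _ _ _ }

variable {f g} in
/-- The universal property of the pullback of internal groupoids. -/
noncomputable def pullbackLift {W : InternalGroupoid C} (a : W ⟶ X) (b : W ⟶ Y)
    (w : a ≫ f = b ≫ g) : W ⟶ pullbackObj f g :=
  homOfGraphHom (Y := (pullbackStructure f g).toGroupoid)
    { f₀ := pullback.lift a.f₀ b.f₀ congr(($w).f₀)
      f₁ := pullback.lift a.f₁ b.f₁ congr(($w).f₁)
      d_f₀ := by apply pullback.hom_ext <;> simp [a.d_f₀, b.d_f₀]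
      c_f₀ := by apply pullback.hom_ext <;> simp [a.c_f₀, b.c_f₀]
      e_f₁ := by apply pullback.hom_ext <;> simp [a.e_f₁, b.e_f₁] }

lemma isPullback_pullbackObj : IsPullback (pullbackFst f g) (pullbackSnd f g) f g where
  w := hom_ext pullback.condition pullback.condition
  isLimit' := ⟨PullbackCone.IsLimit.mk _ (fun s => pullbackLift s.fst s.snd s.condition)
    (fun _ => hom_ext (pullback.lift_fst _ _ _) (pullback.lift_fst _ _ _))
    (fun _ => hom_ext (pullback.lift_snd _ _ _) (pullback.lift_snd _ _ _))
    (fun _ _ h₁ h₂ => hom_ext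
      (pullback.hom_ext (congr(($h₁).f₀).trans (pullback.lift_fst _ _ _).symm)
        (congr(($h₂).f₀).trans (pullback.lift_snd _ _ _).symm))
      (pullback.hom_ext (congr(($h₁).f₁).trans (pullback.lift_fst _ _ _).symm)
        (congr(($h₂).f₁).trans (pullback.lift_snd _ _ _).symm)))⟩

instance : HasPullbacks (InternalGroupoid C) :=
  
  have : ∀ {X Y Z : InternalGroupoid C} {f : X ⟶ Z} {g : Y ⟶ Z}, HasLimit (cospan f g) :=
    fun {_ _ _ f g} => (isPullback_pullbackObj f g).hasPullback
  hasPullbacks_of_hasLimit_cospan _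

/-- Together with its analogue for arrows, this makes the two columns of a double groupoid into
groupoids in `C`. -/
instance : PreservesLimit (cospan f g) (objFunctor C) :=
  preservesLimit_of_preserves_limit_cone (isPullback_pullbackObj f g).isLimit
    ((isLimitMapConePullbackConeEquiv (objFunctor C) (isPullback_pullbackObj f g).w).symm
      (IsPullback.of_hasPullback f.f₀ g.f₀).isLimit)

instance : PreservesLimit (cospan f g) (arrFunctor C) :=
  preservesLimit_of_preserves_limit_cone (isPullback_pullbackObj f g).isLimit
    ((isLimitMapConePullbackConeEquiv (arrFunctor C) (isPullback_pullbackObj f g).w).symm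
      (IsPullback.of_hasPullback f.f₁ g.f₁).isLimit)

lemma mono_f₁ [Mono f] : Mono f.f₁ :=
  preserves_mono_of_preservesLimit (arrFunctor C) f

end Pullback

lemma mono_of_mono_f₀_of_mono_f₁ {X Y : InternalGroupoid C} (f : X ⟶ Y) [Mono f.f₀] [Mono f.f₁] :
    Mono f where
  right_cancellation _ _ h := hom_ext ((cancel_mono f.f₀).1 congr(($h).f₀))
    ((cancel_mono f.f₁).1 congr(($h).f₁))

/-! ### Discrete groupoids -/

section Discrete

variable (A : C)

/-- The discrete reflexive graph. -/
abbrev discreteGraph : InternalReflexiveGraph C where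
  obj := A
  arr := A
  d := 𝟙 A
  c := 𝟙 A
  e := 𝟙 A
  e_d := Category.comp_id _
  e_c := Category.comp_id _

/-- The groupoid structure on the discrete reflexive graph. -/
def discreteStructure : GroupoidStructure (discreteGraph A) where
  mul f _ _ := f
  comp_mul _ _ _ _ := rfl
  mul_d _ _ _ := rfl
  mul_c _ _ w := w
  id_mul _ := by simp
  mul_id _ := rfl
  assoc _ _ _ _ _ := rfl
  i := 𝟙 A
  i_d := Category.comp_id _
  i_c := Category.comp_id _
  mul_i _ := by simp
  i_mul _ := by simp

variable [HasPullbacks C]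

/-- The discrete internal groupoid. -/
noncomputable abbrev discrete : InternalGroupoid C := (discreteStructure A).toGroupoid

variable {A}

/-- Internal functors from a discrete groupoid. -/
noncomputable def homOfDiscrete {X : InternalGroupoid C} (a : A ⟶ X.obj) : discrete A ⟶ X :=
  homMk (X := discrete A)
    { f₀ := a
      f₁ := a ≫ X.e
      d_f₀ := by simp
      c_f₀ := by simp
      e_f₁ := by simp }
    (fun f g w => by
      rw [UnitalComposition.toCompGraph_mul]
      have : f = g := by simpa using w
      subst this
      exact (X.groupoidStructure.mul_id_of_eq _ _ (f ≫ a) (by simp) _).symm)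

/-- Internal functors to a discrete groupoid. -/
noncomputable def homToDiscrete {X : InternalGroupoid C} (a : X.obj ⟶ A)
    (h : X.d ≫ a = X.c ≫ a) : X ⟶ discrete A :=
  homMk (Y := discrete A)
    { f₀ := a
      f₁ := X.d ≫ a
      d_f₀ := by simp
      c_f₀ := by simp [h]
      e_f₁ := by simp }
    (fun f g w => by
      rw [UnitalComposition.toCompGraph_mul, ← Category.assoc, X.mul_d, Category.assoc]
      rfl)

/-- Generalized elements of the object of objects are functors from a discrete groupoid. -/
lemma mono_f₀ {X Y : InternalGroupoid C} (f : X ⟶ Y) [Mono f] : Mono f.f₀ where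
  right_cancellation a b h := by
    have : homOfDiscrete a ≫ f = homOfDiscrete b ≫ f :=
      hom_ext h (by
        change (a ≫ X.e) ≫ f.f₁ = (b ≫ X.e) ≫ f.f₁
        simp [f.e_f₁, reassoc_of% h])
    exact congr(($((cancel_mono f).1 this)).f₀)

end Discrete

/-! ### Indiscrete groupoids -/

section Indiscrete

variable [HasFiniteLimits C] (A : C)

/-- The indiscrete reflexive graph. -/
noncomputable abbrev indiscreteGraph : InternalReflexiveGraph C where
  obj := A
  arr := A ⨯ A
  d := prod.fst
  c := prod.snd
  e := prod.lift (𝟙 A) (𝟙 A)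
  e_d := prod.lift_fst _ _
  e_c := prod.lift_snd _ _

/-- The groupoid structure on the indiscrete reflexive graph. -/
noncomputable def indiscreteStructure : GroupoidStructure (indiscreteGraph A) where
  mul f g _ := prod.lift (f ≫ prod.fst) (g ≫ prod.snd)
  comp_mul _ _ _ _ := by simp
  mul_d _ _ _ := prod.lift_fst _ _
  mul_c _ _ w := prod.lift_snd _ _
  id_mul _ := by apply Limits.prod.hom_ext <;> simp
  mul_id _ := by apply Limits.prod.hom_ext <;> simp
  assoc _ _ _ _ _ := by apply Limits.prod.hom_ext <;> simp
  i := prod.lift prod.snd prod.fst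
  i_d := prod.lift_fst _ _
  i_c := prod.lift_snd _ _
  mul_i _ := by apply Limits.prod.hom_ext <;> simp
  i_mul _ := by apply Limits.prod.hom_ext <;> simp

/-- The indiscrete internal groupoid. -/
noncomputable abbrev indiscrete : InternalGroupoid C := (indiscreteStructure A).toGroupoid

variable {A}

/-- Internal functors to an indiscrete groupoid. -/
noncomputable def homToIndiscrete {X : InternalGroupoid C} (a : X.obj ⟶ A) :
    X ⟶ indiscrete A :=
  homMk (Y := indiscrete A)
    { f₀ := a
      f₁ := prod.lift (X.d ≫ a) (X.c ≫ a)
      d_f₀ := by simp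
      c_f₀ := by simp
      e_f₁ := by apply Limits.prod.hom_ext <;> simp }
    (fun f g w => by
      rw [UnitalComposition.toCompGraph_mul]
      apply Limits.prod.hom_ext
      · have := X.mul_d f g w
        simp [indiscreteStructure, reassoc_of% this]
      · have := X.mul_c f g w
        simp [indiscreteStructure, reassoc_of% this])

lemma hom_ext_of_indiscrete {X : InternalGroupoid C} {f g : X ⟶ indiscrete A}
    (h : f.f₀ = g.f₀) : f = g :=
  hom_ext h (by
    apply Limits.prod.hom_ext
    · exact f.d_f₀.symm.trans (.trans (by rw [h]) g.d_f₀)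
    · exact f.c_f₀.symm.trans (.trans (by rw [h]) g.c_f₀))

/-- Morphisms out of the object of objects correspond to functors into indiscrete groupoids, so a
coequalizer of groupoids restricts to one of objects. -/
theorem isRegularEpi_f₀ {X Y : InternalGroupoid C} (f : X ⟶ Y) [IsRegularEpi f] :
    IsRegularEpi f.f₀ := by
  obtain ⟨⟨h⟩⟩ := ‹IsRegularEpi f›
  have desc : ∀ {A : C} (k : X.obj ⟶ A), h.left.f₀ ≫ k = h.right.f₀ ≫ k →
      ∃ l : Y.obj ⟶ A, f.f₀ ≫ l = k := fun k hk => by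
    obtain ⟨l, hl⟩ := h.desc' (homToIndiscrete k) (hom_ext_of_indiscrete hk)
    exact ⟨l.f₀, congr(($hl).f₀)⟩
  have : Epi f := h.epi
  have : Epi f.f₀ := ⟨fun a b hab => by
    have : f ≫ homToIndiscrete a = f ≫ homToIndiscrete b := hom_ext_of_indiscrete hab
    exact congr(($((cancel_epi f).1 this)).f₀)⟩
  exact ⟨⟨{
    W := h.W.obj
    left := h.left.f₀
    right := h.right.f₀
    w := congr(($(h.w)).f₀)
    isColimit := Cofork.IsColimit.mk' _ fun s =>
      ⟨(desc s.π s.condition).choose, (desc s.π s.condition).choose_spec, fun {m} hm => by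
        rw [← cancel_epi f.f₀, (desc s.π s.condition).choose_spec]
        exact hm⟩ }⟩⟩

end Indiscrete

/-- Makes indiscrete groupoids available inside `InternalGroupoid C`, as needed to apply
`isRegularEpi_f₀` to double groupoids. -/
instance [HasFiniteLimits C] [IsMaltsev C] : HasFiniteLimits (InternalGroupoid C) :=
  have : HasTerminal (InternalGroupoid C) :=
    IsTerminal.hasTerminal (X := discrete (⊤_ C)) (IsTerminal.ofUniqueHom
      (fun _ => homToDiscrete (terminal.from _) (Subsingleton.elim _ _))
      (fun _ _ => hom_ext (Subsingleton.elim _ _) (Subsingleton.elim _ _)))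
  hasFiniteLimits_of_hasTerminal_and_pullbacks

end InternalGroupoid

/-! ### Descent of equations along epimorphisms -/

section Epi

variable {C : Type u} [Category.{v} C] {A A' B B' Z Z' : C}

lemma comp_eq_comp_of_epi {p : A ⟶ B} [Epi p] {p' : A' ⟶ B'} {x : A ⟶ A'} {y : B ⟶ B'}
    {h : B ⟶ Z} {h' : B' ⟶ Z'} {z : Z ⟶ Z'} {f : A ⟶ Z} {f' : A' ⟶ Z'} (sq : x ≫ p' = p ≫ y)
    (hp : p ≫ h = f) (hp' : p' ≫ h' = f') (hf : x ≫ f' = f ≫ z) : y ≫ h' = h ≫ z := by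
  rw [← cancel_epi p, ← Category.assoc, ← sq, Category.assoc, hp', hf, ← hp, Category.assoc]

lemma comp_eq_id_of_epi {p : A ⟶ B} [Epi p] {p' : A' ⟶ B'} {x : A ⟶ A'} {y : A' ⟶ A}
    {x' : B ⟶ B'} {y' : B' ⟶ B} (hx : p ≫ x' = x ≫ p') (hy : p' ≫ y' = y ≫ p)
    (h : x ≫ y = 𝟙 A) : x' ≫ y' = 𝟙 B := by
  rw [← cancel_epi p, ← Category.assoc, hx, Category.assoc, hy, ← Category.assoc, h,
    Category.id_comp, Category.comp_id]

end Epi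

/-! ### Pushforward of a reflexive graph along a map of objects -/

namespace InternalReflexiveGraph

variable {C : Type u} [Category.{v} C] [HasPushouts C]

attribute [local simp] pushout.inl_desc pushout.inr_desc pushout.inl_desc_assoc
  pushout.inr_desc_assoc

/-- The reflexive graph obtained by pushing out the identities along a morphism from the object of
objects. -/
noncomputable abbrev pushforward (G : InternalReflexiveGraph C) {Q : C} (q : G.obj ⟶ Q) :
    InternalReflexiveGraph C where
  obj := Q
  arr := pushout G.e q
  d := pushout.desc (G.d ≫ q) (𝟙 Q) (by simp)
  c := pushout.desc (G.c ≫ q) (𝟙 Q) (by simp)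
  e := pushout.inr _ _
  e_d := pushout.inr_desc _ _ _
  e_c := pushout.inr_desc _ _ _

variable (G : InternalReflexiveGraph C) {Q : C} (q : G.obj ⟶ Q)

/-- The universal morphism to the pushforward of a reflexive graph. -/
noncomputable def toPushforward : GraphHom G (G.pushforward q) where
  f₀ := q
  f₁ := pushout.inl _ _
  d_f₀ := (pushout.inl_desc _ _ _).symm
  c_f₀ := (pushout.inl_desc _ _ _).symm
  e_f₁ := pushout.condition

variable {G} in
/-- The universal property of the pushforward of a reflexive graph. -/
noncomputable def GraphHom.descPushforward {H : InternalReflexiveGraph C} (φ : GraphHom G H)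
    (l : Q ⟶ H.obj) (h : φ.f₀ = q ≫ l) : GraphHom (G.pushforward q) H where
  f₀ := l
  f₁ := pushout.desc φ.f₁ (l ≫ H.e) (by rw [φ.e_f₁, h, Category.assoc])
  d_f₀ := by
    apply pushout.hom_ext
    · simp [← φ.d_f₀, h]
    · simp
  c_f₀ := by
    apply pushout.hom_ext
    · simp [← φ.c_f₀, h]
    · simp
  e_f₁ := pushout.inr_desc _ _ _

end InternalReflexiveGraph

/-! ### Double groupoids, level by level -/

namespace DoubleGroupoid

open InternalReflexiveGraph InternalGroupoid

variable {C : Type u} [Category.{v} C]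

section Maltsev

variable [HasFiniteLimits C] [IsMaltsev C]

/-- A reflexive graph of internal groupoids in a Mal'tsev category is a groupoid as soon as its
graphs of objects and of arrows are. -/
noncomputable def structureOfLevels (G : InternalReflexiveGraph (InternalGroupoid C))
    (S₀ : GroupoidStructure (G.map (objFunctor C)))
    (S₁ : GroupoidStructure (G.map (arrFunctor C))) : GroupoidStructure G where
  mul {T} f g w := homOfGraphHom
    { f₀ := S₀.mul f.f₀ g.f₀ congr(($w).f₀)
      f₁ := S₁.mul f.f₁ g.f₁ congr(($w).f₁)
      d_f₀ := by
        -- The domain maps of the rows form a morphism between the reflexive graphs of arrows and of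
        -- objects, so they preserve composition automatically.
        refine .trans ?_ ((G.mapNatTrans (dTrans C)).mul_f₁ S₁.toUnitalComposition
          S₀.toUnitalComposition _ _ _).symm
        exact (S₀.comp_mul _ _ _ _).trans (S₀.mul_congr f.d_f₀ g.d_f₀ _)
      c_f₀ := by
        refine .trans ?_ ((G.mapNatTrans (cTrans C)).mul_f₁ S₁.toUnitalComposition
          S₀.toUnitalComposition _ _ _).symm
        exact (S₀.comp_mul _ _ _ _).trans (S₀.mul_congr f.c_f₀ g.c_f₀ _)
      e_f₁ := by
        refine .trans ?_ ((G.mapNatTrans (eTrans C)).mul_f₁ S₀.toUnitalComposition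
          S₁.toUnitalComposition _ _ _).symm
        exact (S₁.comp_mul _ _ _ _).trans (S₁.mul_congr f.e_f₁ g.e_f₁ _) }
  comp_mul _ _ _ _ := hom_ext (S₀.comp_mul _ _ _ _) (S₁.comp_mul _ _ _ _)
  mul_d _ _ _ := hom_ext (S₀.mul_d _ _ _) (S₁.mul_d _ _ _)
  mul_c _ _ _ := hom_ext (S₀.mul_c _ _ _) (S₁.mul_c _ _ _)
  id_mul _ := hom_ext (S₀.id_mul _) (S₁.id_mul _)
  mul_id _ := hom_ext (S₀.mul_id _) (S₁.mul_id _)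
  assoc _ _ _ w w' := hom_ext (S₀.assoc _ _ _ congr(($w).f₀) congr(($w').f₀))
    (S₁.assoc _ _ _ congr(($w).f₁) congr(($w').f₁))
  i := homOfGraphHom
    { f₀ := S₀.i
      f₁ := S₁.i
      d_f₀ := ((G.mapNatTrans (dTrans C)).i_f₁ S₁ S₀).symm
      c_f₀ := ((G.mapNatTrans (cTrans C)).i_f₁ S₁ S₀).symm
      e_f₁ := ((G.mapNatTrans (eTrans C)).i_f₁ S₀ S₁).symm }
  i_d := hom_ext S₀.i_d S₁.i_d
  i_c := hom_ext S₀.i_c S₁.i_c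
  mul_i _ := hom_ext (S₀.mul_i _) (S₁.mul_i _)
  i_mul _ := hom_ext (S₀.i_mul _) (S₁.i_mul _)

/-- Morphisms of the reflexive graphs of internal groupoids underlying double groupoids in a
Mal'tsev category are internal functors. -/
noncomputable def homOfGraphHom {X Y : DoubleGroupoid C}
    (φ : GraphHom X.toInternalReflexiveGraph Y.toInternalReflexiveGraph) : X ⟶ Y :=
  homMk φ fun {T} f g w => by
    -- The Mal'tsev property is used only in `C`: the equation is tested after the object and arrow
    -- functors, which are jointly faithful.
    have key : ∀ (F : InternalGroupoid C ⥤ C) [PreservesLimit (cospan X.c X.d) F]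
        [PreservesLimit (cospan Y.c Y.d) F], F.map (X.mul f g w ≫ φ.f₁) =
          F.map (Y.mul (f ≫ φ.f₁) (g ≫ φ.f₁) (φ.comp_eq w)) := fun F _ _ => by
      rw [F.map_comp, functor_map_mul, functor_map_mul]
      refine ((φ.map F).mul_f₁ (X.mapGroupoidStructure F).toUnitalComposition
        (Y.mapGroupoidStructure F).toUnitalComposition _ _ _).trans ?_
      exact UnitalComposition.mul_congr _ (F.map_comp _ _).symm (F.map_comp _ _).symm _
    exact hom_ext (key (objFunctor C)) (key (arrFunctor C))

/-- A monomorphism of double groupoids is monic on `X.obj.arr`, so the equation `d⁰ ≫ e⁰ = 𝟙` can be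
cancelled back from `Y` to `X`. -/
theorem isTwoGroupoid_isClosedUnderSubobjects : (isTwoGroupoid C).IsClosedUnderSubobjects where
  prop_of_mono {X Y} f _ hY := by
    have : IsIso Y.obj.e := hY
    have hd : Y.obj.d ≫ Y.obj.e = 𝟙 _ := by
      rw [← cancel_epi Y.obj.e]
      simp
    have : Mono f.f₀ := mono_f₀ f
    have : Mono f.f₀.f₁ := mono_f₁ f.f₀
    refine ⟨X.obj.d, X.obj.e_d, ?_⟩
    rw [← cancel_mono f.f₀.f₁, Category.assoc, f.f₀.e_f₁, ← Category.assoc, f.f₀.d_f₀,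
      Category.assoc, hd, Category.comp_id, Category.id_comp]

/-- The bottom row of `X` is discrete, so the regular epimorphism of bottom rows factors through the
discrete groupoid on `Y.obj.obj`. The latter embeds in `Y.obj`, so the embedding is invertible; on
arrows it is `e⁰`. -/
theorem isTwoGroupoid_of_isRegularEpi {X Y : DoubleGroupoid C} (f : X ⟶ Y) (hf : IsRegularEpi f)
    (hX : isTwoGroupoid C X) : isTwoGroupoid C Y := by
  have : IsIso X.obj.e := hX
  have hd : X.obj.d ≫ X.obj.e = 𝟙 _ := by
    rw [← cancel_epi X.obj.e]
    simp
  have hdc : X.obj.d = X.obj.c := by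
    rw [← cancel_epi X.obj.e]
    simp
  have : IsRegularEpi f.f₀ := isRegularEpi_f₀ f
  let p : X.obj ⟶ discrete Y.obj.obj := homToDiscrete f.f₀.f₀ (by rw [hdc])
  let i : discrete Y.obj.obj ⟶ Y.obj := homOfDiscrete (𝟙 _)
  have fac : p ≫ i = f.f₀ := hom_ext (Category.comp_id _) (by
    change (X.obj.d ≫ f.f₀.f₀) ≫ 𝟙 _ ≫ Y.obj.e = _
    rw [Category.id_comp, Category.assoc, ← f.f₀.e_f₁, ← Category.assoc, hd, Category.id_comp])
  have : Mono i.f₀ := inferInstanceAs (Mono (𝟙 Y.obj.obj))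
  have : Mono i.f₁ := by
    have : i.f₁ = Y.obj.e := Category.id_comp _
    rw [this]
    exact mono_of_mono_fac Y.obj.e_d
  have : Mono i := mono_of_mono_f₀_of_mono_f₁ i
  have : IsIso i := ExtremalEpi.isIso f.f₀ p i fac
  have : IsIso i.f₁ := inferInstanceAs (IsIso ((arrFunctor C).map i))
  change IsIso Y.obj.e
  rw [← Category.id_comp Y.obj.e]
  exact this

end Maltsev

/-! ### Construction of the reflection -/

section Reflection

variable [HasFiniteColimits C] (X : DoubleGroupoid C)

/-- The object of objects of the reflection of a double groupoid in 2-groupoids. -/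
noncomputable abbrev reflectionObj : C := coequalizer X.obj.d X.obj.c

/-- The component of the unit at the object of objects. -/
noncomputable abbrev unitObj : X.obj.obj ⟶ reflectionObj X := coequalizer.π _ _

/-- The component of the unit at the object of arrows of the bottom row. -/
noncomputable abbrev unitArr : X.obj.arr ⟶ reflectionObj X := X.obj.d ≫ unitObj X

/-- The first column of the reflection. -/
noncomputable abbrev objColumn : InternalReflexiveGraph C :=
  (X.toInternalReflexiveGraph.map (objFunctor C)).pushforward (unitObj X)

/-- The second column of the reflection. -/
noncomputable abbrev arrColumn : InternalReflexiveGraph C :=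
  (X.toInternalReflexiveGraph.map (arrFunctor C)).pushforward (unitArr X)

/-- The unit on the first columns. -/
noncomputable abbrev unitObjColumn :
    GraphHom (X.toInternalReflexiveGraph.map (objFunctor C)) (objColumn X) :=
  toPushforward _ _

/-- The unit on the second columns. -/
noncomputable abbrev unitArrColumn :
    GraphHom (X.toInternalReflexiveGraph.map (arrFunctor C)) (arrColumn X) :=
  toPushforward _ _

/-- The domain of rows, as a morphism between the columns of the reflection. -/
noncomputable abbrev columnD : GraphHom (arrColumn X) (objColumn X) :=
  ((mapNatTrans _ (dTrans C)).comp (unitObjColumn X)).descPushforward _ (𝟙 _)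
    (Category.comp_id _).symm

/-- The codomain of rows, as a morphism between the columns of the reflection. -/
noncomputable abbrev columnC : GraphHom (arrColumn X) (objColumn X) :=
  ((mapNatTrans _ (cTrans C)).comp (unitObjColumn X)).descPushforward _ (𝟙 _)
    -- `unitArr` is defined through `d⁰`; the coequalizer condition shows that it also equals `c⁰`
    -- followed by `unitObj`.
    ((coequalizer.condition _ _).symm.trans (Category.comp_id _).symm)

/-- The identities of rows, as a morphism between the columns of the reflection. -/
noncomputable abbrev columnE : GraphHom (objColumn X) (arrColumn X) :=
  ((mapNatTrans _ (eTrans C)).comp (unitArrColumn X)).descPushforward _ (𝟙 _)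
    ((X.obj.e_d_assoc (unitObj X)).trans (Category.comp_id _).symm)

lemma unitArrColumn_comp_columnD :
    (unitArrColumn X).f₁ ≫ (columnD X).f₁ = X.arr.d ≫ (unitObjColumn X).f₁ :=
  pushout.inl_desc _ _ _

lemma unitArrColumn_comp_columnC :
    (unitArrColumn X).f₁ ≫ (columnC X).f₁ = X.arr.c ≫ (unitObjColumn X).f₁ :=
  pushout.inl_desc _ _ _

lemma unitObjColumn_comp_columnE :
    (unitObjColumn X).f₁ ≫ (columnE X).f₁ = X.arr.e ≫ (unitArrColumn X).f₁ :=
  pushout.inl_desc _ _ _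

variable [Regular C]

instance : IsRegularEpi (unitArr X) :=
  have : IsSplitEpi X.obj.d := ⟨⟨X.obj.e, X.obj.e_d⟩⟩
  IsRegularEpi.comp_of_regular _ _

/-- Regularity of this map and of the next one is what lets the columns and the top row inherit
groupoid structures. -/
instance : IsRegularEpi (unitObjColumn X).f₁ :=
  IsRegularEpi.of_isPushout (IsPushout.of_hasPushout X.e.f₀ (unitObj X))

instance : IsRegularEpi (unitArrColumn X).f₁ :=
  IsRegularEpi.of_isPushout (IsPushout.of_hasPushout X.e.f₁ (unitArr X))

/-- The top row of the reflection. -/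
noncomputable abbrev topRow : InternalReflexiveGraph C where
  obj := (objColumn X).arr
  arr := (arrColumn X).arr
  d := (columnD X).f₁
  c := (columnC X).f₁
  e := (columnE X).f₁
  e_d := comp_eq_id_of_epi (p := (unitObjColumn X).f₁)
    (unitObjColumn_comp_columnE X) (unitArrColumn_comp_columnD X) X.arr.e_d
  e_c := comp_eq_id_of_epi (p := (unitObjColumn X).f₁)
    (unitObjColumn_comp_columnE X) (unitArrColumn_comp_columnC X) X.arr.e_c

/-- The unit on the top rows. -/
noncomputable def unitTopRow : GraphHom X.arr.toInternalReflexiveGraph (topRow X) where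
  f₀ := (unitObjColumn X).f₁
  f₁ := (unitArrColumn X).f₁
  d_f₀ := (unitArrColumn_comp_columnD X).symm
  c_f₀ := (unitArrColumn_comp_columnC X).symm
  e_f₁ := (unitObjColumn_comp_columnE X).symm

instance : IsRegularEpi (unitTopRow X).f₀ := inferInstanceAs (IsRegularEpi (unitObjColumn X).f₁)

instance : IsRegularEpi (unitTopRow X).f₁ := inferInstanceAs (IsRegularEpi (unitArrColumn X).f₁)

variable [IsMaltsev C]

/-- The groupoid of arrows of the reflection. -/
noncomputable abbrev topGroupoid : InternalGroupoid C :=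
  ((unitTopRow X).quotientStructure X.arr.groupoidStructure).toGroupoid

/-- The groupoid of objects of the reflection. -/
noncomputable abbrev bottomGroupoid : InternalGroupoid C := discrete (reflectionObj X)

/-- The reflexive graph of internal groupoids underlying the reflection. -/
noncomputable abbrev reflectionGraph : InternalReflexiveGraph (InternalGroupoid C) where
  obj := bottomGroupoid X
  arr := topGroupoid X
  d := InternalGroupoid.homOfGraphHom (X := topGroupoid X) (Y := bottomGroupoid X)
    { f₀ := (objColumn X).d
      f₁ := (arrColumn X).d
      d_f₀ := (columnD X).d_f₀.symm
      c_f₀ := (columnC X).d_f₀.symm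
      e_f₁ := (columnE X).d_f₀.symm }
  c := InternalGroupoid.homOfGraphHom (X := topGroupoid X) (Y := bottomGroupoid X)
    { f₀ := (objColumn X).c
      f₁ := (arrColumn X).c
      d_f₀ := (columnD X).c_f₀.symm
      c_f₀ := (columnC X).c_f₀.symm
      e_f₁ := (columnE X).c_f₀.symm }
  e := InternalGroupoid.homOfGraphHom (X := bottomGroupoid X) (Y := topGroupoid X)
    { f₀ := (objColumn X).e
      f₁ := (arrColumn X).e
      d_f₀ := (columnD X).e_f₁.symm
      c_f₀ := (columnC X).e_f₁.symm
      e_f₁ := (columnE X).e_f₁.symm }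
  e_d := hom_ext (objColumn X).e_d (arrColumn X).e_d
  e_c := hom_ext (objColumn X).e_c (arrColumn X).e_c

/-- The groupoid structure on the reflection. -/
noncomputable def reflectionStructure : GroupoidStructure (reflectionGraph X) :=
  structureOfLevels _
    ((unitObjColumn X).quotientStructure (X.mapGroupoidStructure (objFunctor C)))
    ((unitArrColumn X).quotientStructure (X.mapGroupoidStructure (arrFunctor C)))

/-- The reflection of a double groupoid in 2-groupoids. -/
noncomputable abbrev reflection : DoubleGroupoid C := (reflectionStructure X).toGroupoid

/-- The unit of the reflection of double groupoids in 2-groupoids. -/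
noncomputable def unit : X ⟶ reflection X :=
  homOfGraphHom (Y := reflection X)
    { f₀ := InternalGroupoid.homOfGraphHom (Y := bottomGroupoid X)
        { f₀ := unitObj X
          f₁ := unitArr X
          d_f₀ := (Category.comp_id _).symm
          c_f₀ := (coequalizer.condition _ _).symm.trans (Category.comp_id _).symm
          e_f₁ := by simp }
      f₁ := InternalGroupoid.homOfGraphHom (Y := topGroupoid X) (unitTopRow X)
      d_f₀ := hom_ext (unitObjColumn X).d_f₀ (unitArrColumn X).d_f₀
      c_f₀ := hom_ext (unitObjColumn X).c_f₀ (unitArrColumn X).c_f₀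
      e_f₁ := hom_ext (unitObjColumn X).e_f₁ (unitArrColumn X).e_f₁ }

theorem isTwoGroupoid_reflection : isTwoGroupoid C (reflection X) :=
  inferInstanceAs (IsIso (𝟙 (reflectionObj X)))

theorem isCoequalizerPushoutConstruction_unit : IsCoequalizerPushoutConstruction (unit X) where
  isTwoGroupoid := isTwoGroupoid_reflection X
  w := coequalizer.condition _ _
  isCoequalizer := ⟨coequalizerIsCoequalizer X.obj.d X.obj.c⟩
  isPushout₀ := IsPushout.of_hasPushout X.e.f₀ (unitObj X)
  η₁_eq := (Category.comp_id _).symm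
  isPushout₁ := IsPushout.of_hasPushout X.e.f₁ (unitArr X)

/-! ### Universal property of the reflection -/

variable {X} {Y : DoubleGroupoid C}

/-- All four components of the unit are epimorphisms. -/
lemma unit_hom_ext {f g : reflection X ⟶ Y} (h : unit X ≫ f = unit X ≫ g) : f = g := by
  apply hom_ext
  · apply hom_ext
    · exact (cancel_epi (unitObj X)).1 congr(($h).f₀.f₀)
    · exact (cancel_epi (unitArr X)).1 congr(($h).f₀.f₁)
  · apply hom_ext
    · exact (cancel_epi (unitObjColumn X).f₁).1 congr(($h).f₁.f₀)
    · exact (cancel_epi (unitArrColumn X).f₁).1 congr(($h).f₁.f₁)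

/-- Since `d⁰ = c⁰` in `Y`, the object component factors through the coequalizer, and the pushouts
supply the columns. Compatibility with the top row is checked after the epic unit, and preservation
of composition is automatic. -/
theorem exists_unit_comp_eq (f : X ⟶ Y) (hY : isTwoGroupoid C Y) :
    ∃ g : reflection X ⟶ Y, unit X ≫ g = f := by
  have : IsIso Y.obj.e := hY
  have hd : Y.obj.d ≫ Y.obj.e = 𝟙 _ := by
    rw [← cancel_epi Y.obj.e]
    simp
  have hdc : Y.obj.d = Y.obj.c := by
    rw [← cancel_epi Y.obj.e]
    simp
  let l : reflectionObj X ⟶ Y.obj.obj :=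
    coequalizer.desc f.f₀.f₀ (by rw [f.f₀.d_f₀, f.f₀.c_f₀, hdc])
  have hl : unitObj X ≫ l = f.f₀.f₀ := coequalizer.π_desc _ _
  have hl' : unitArr X ≫ l ≫ Y.obj.e = f.f₀.f₁ := by
    rw [Category.assoc, reassoc_of% hl, reassoc_of% f.f₀.d_f₀, hd, Category.comp_id]
  let φ₀ := GraphHom.descPushforward (G := X.toInternalReflexiveGraph.map (objFunctor C))
    (unitObj X) ((Hom.toGraphHom f).map (objFunctor C)) l hl.symm
  let φ₁ := GraphHom.descPushforward (G := X.toInternalReflexiveGraph.map (arrFunctor C))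
    (unitArr X) ((Hom.toGraphHom f).map (arrFunctor C)) (l ≫ Y.obj.e) hl'.symm
  have h₀ : (unitObjColumn X).f₁ ≫ φ₀.f₁ = f.f₁.f₀ := pushout.inl_desc _ _ _
  have h₁ : (unitArrColumn X).f₁ ≫ φ₁.f₁ = f.f₁.f₁ := pushout.inl_desc _ _ _
  let g₀ : bottomGroupoid X ⟶ Y.obj := homOfDiscrete l
  let g₁ : topGroupoid X ⟶ Y.arr := InternalGroupoid.homOfGraphHom (X := topGroupoid X)
    { f₀ := φ₀.f₁
      f₁ := φ₁.f₁
      d_f₀ := comp_eq_comp_of_epi (unitTopRow X).d_f₀ h₁ h₀ f.f₁.d_f₀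
      c_f₀ := comp_eq_comp_of_epi (unitTopRow X).c_f₀ h₁ h₀ f.f₁.c_f₀
      e_f₁ := comp_eq_comp_of_epi (unitTopRow X).e_f₁ h₀ h₁ f.f₁.e_f₁ }
  let g : reflection X ⟶ Y := homOfGraphHom (X := reflection X)
    { f₀ := g₀
      f₁ := g₁
      d_f₀ := hom_ext φ₀.d_f₀ φ₁.d_f₀
      c_f₀ := hom_ext φ₀.c_f₀ φ₁.c_f₀
      e_f₁ := hom_ext φ₀.e_f₁ φ₁.e_f₁ }
  exact ⟨g, hom_ext (hom_ext hl hl') (hom_ext h₀ h₁)⟩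

variable (C)

/-- The morphisms from the reflection of a double groupoid to a 2-groupoid. -/
noncomputable def reflectionHomEquiv (X : DoubleGroupoid C) (Y : TwoGroupoid C) :
    ((⟨reflection X, isTwoGroupoid_reflection X⟩ : TwoGroupoid C) ⟶ Y) ≃
      (X ⟶ (isTwoGroupoid C).ι.obj Y) where
  toFun g := unit X ≫ (isTwoGroupoid C).ι.map g
  invFun f := ObjectProperty.homMk (exists_unit_comp_eq f Y.property).choose
  left_inv g := by
    apply (isTwoGroupoid C).ι.map_injective
    apply unit_hom_ext
    exact (exists_unit_comp_eq (unit X ≫ (isTwoGroupoid C).ι.map g) Y.property).choose_spec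
  right_inv f := (exists_unit_comp_eq f Y.property).choose_spec

/-- The adjunction exhibiting 2-groupoids as a reflective subcategory of double groupoids. -/
noncomputable def reflectionAdjunction :
    Adjunction.leftAdjointOfEquiv (G := (isTwoGroupoid C).ι) (reflectionHomEquiv C)
      (fun _ _ _ _ _ => by simp [reflectionHomEquiv]) ⊣ (isTwoGroupoid C).ι :=
  Adjunction.adjunctionOfEquivLeft _ _

lemma reflectionAdjunction_unit_app (X : DoubleGroupoid C) :
    (reflectionAdjunction C).unit.app X = unit X := by
  rw [← Adjunction.homEquiv_id]
  simp only [reflectionAdjunction, Adjunction.adjunctionOfEquivLeft,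
    Adjunction.mkOfHomEquiv_homEquiv]
  exact Category.comp_id (unit X)

end Reflection

end DoubleGroupoid

open DoubleGroupoid in
theorem theorem1 {C : Type u} [Category.{v} C] [Regular C] [IsMaltsev C] [HasFiniteColimits C] :
    IsBirkhoff (isTwoGroupoid C) ∧
    ∃ (F : DoubleGroupoid C ⥤ TwoGroupoid C) (adj : F ⊣ (isTwoGroupoid C).ι),
      ∀ X : DoubleGroupoid C, IsCoequalizerPushoutConstruction (adj.unit.app X) := by
  have := isTwoGroupoid_isClosedUnderSubobjects (C := C)
  refine ⟨⟨inferInstance, ⟨⟨_, reflectionAdjunction C⟩⟩, this,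
    fun _ _ f hf => isTwoGroupoid_of_isRegularEpi f hf⟩, _, reflectionAdjunction C, fun X => ?_⟩
  rw [reflectionAdjunction_unit_app]
  exact isCoequalizerPushoutConstruction_unit X
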